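/- Let $G=(V,E)$ be an undirected connected graph with $V=\{0,\dots,n-1\}$, and let $\mathbf M^{(1)},\dots,\mathbf M^{(d)}\subseteq E$ be $d\ge 1$ matchings of $G$. Identify each matching with its $n\times n$ matching matrix: $\mathbf M^{(i)}_{u,u}=\mathbf M^{(i)}_{v,v}=\mathbf M^{(i)}_{u,v}=\mathbf M^{(i)}_{v,u}=\tfrac12$ if $\{u,v\}$ is in the matching, $\mathbf M^{(i)}_{u,u}=1$ if $u$ is unmatched, and all other entries are $0$. Let $\mathbf M=\mathbf M^{(1)}\cdots\mathbf M^{(d)}$ be the round matrix, and assume $\lambda(\mathbf M)<1$, where $\lambda(\mathbf M)$ is the second largest eigenvalue in absolute value of $\mathbf M$ if $\mathbf M$ is symmetric, and the second largest eigenvalue of $\mathbf M\mathbf M^{T}$ otherwise (eigenvalues counted with multiplicity; no condition if $n=1$). In the (discrete) balancing circuit model, each round applies the matchings $\mathbf M^{(1)},\dots,\mathbf M^{(d)}$ in this order; when a matching containing $\{u,v\}$ is applied and $u,v$ have loads $a,b$, one of the two nodes gets $\lceil\frac{a+b}{2}\rceil$ and the other $\lfloor\frac{a+b}{2}\rfloor$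 tokens, each of the two assignments having probability $\tfrac12$, independently of all other choices and of the initial loads; unmatched nodes keep their load. Let $x^{(t)}\in\mathbb Z^n$ be the load vector after $t$ rounds (that is, after $td$ matchings), and $\operatorname{disc}(x)=\max_i x_i-\min_i x_i$. Let $\kappa>0$ and let $D$ be a probability distribution on $\{0,1,2,\dots\}$ with expectation $\mu$ and finite variance $\sigma^2$ that is exponentially concentrated with constant $\kappa$: for $X\sim D$ and every $\delta>0$, $\Pr[|X-\mu|\ge\delta\sigma]\le e^{-\kappa\delta}$. Let the initial loads $x^{(0)}_u$, $u\in V$, be independent with distribution $D$ (the average case). Then there is a constant $C>0$ depending only on $d$ and $\kappa$ (not on $n$, $G$, the matchings, $D$ or $t$) such that for every round $t\ge 1$, $$\Pr\Big[\operatorname{disc}(x^{(t)})\le C\big(t^{-1/4}\,\sigma\,(\log n)^{3/2}+\sqrt{\log n}\big)\Big]\ \ge\ 1-\frac{C}{n}.$$ -/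

import Mathlib

open MeasureTheory ProbabilityTheory

namespace LoadBalancing

noncomputable section

/-! Matchings are subgraphs satisfying `SimpleGraph.Subgraph.IsMatching`. -/

open Classical in
/-- The matching matrix of a matching `N`: the entries `(u,u)`, `(v,v)`, `(u,v)`, `(v,u)` equal `1/2`
for every matched pair `{u,v}`; unmatched nodes have diagonal entry `1`; all other entries vanish. -/
def matchingMatrix {n : ℕ} {G : SimpleGraph (Fin n)} (N : G.Subgraph) :
    Matrix (Fin n) (Fin n) ℝ :=
  Matrix.of fun u v =>
    if ∃ w, N.Adj u w then (if u = v ∨ N.Adj u v then 1 / 2 else 0)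
    else (if u = v then 1 else 0)

/-- The round matrix: the ordered product of the `d` matching matrices of one period. -/
def roundMatrix {n d : ℕ} {G : SimpleGraph (Fin n)} (N : Fin d → G.Subgraph) :
    Matrix (Fin n) (Fin n) ℝ :=
  (List.ofFn fun i => matchingMatrix (N i)).prod

/-- The second largest element of a multiset of reals, counted with multiplicity
(and `0` if there are fewer than two elements). -/
def secondLargest (s : Multiset ℝ) : ℝ := (s.sort (· ≥ ·)).getD 1 0

open Classical in
/-- `λ(M)`: the second largest eigenvalue in absolute value of `M` if `M` is symmetric, and otherwise
the second largest eigenvalue of the symmetric matrix `M * Mᵀ`; eigenvalues are counted with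
multiplicity, as roots of the characteristic polynomial. -/
def secondEigenvalue {n : ℕ} (M : Matrix (Fin n) (Fin n) ℝ) : ℝ :=
  if M.IsSymm then secondLargest (M.charpoly.roots.map fun x => |x|)
  else secondLargest (M * M.transpose).charpoly.roots

open Classical in
/-- The partner of `u` in the matching `N`, and `u` itself if `u` is not matched. -/
def partner {n : ℕ} {G : SimpleGraph (Fin n)} (N : G.Subgraph) (u : Fin n) : Fin n :=
  if h : ∃ v, N.Adj u v then h.choose else u

open Classical in
/-- One step of discrete balancing along the matching `N`. A matched pair `{u,v}` with `u < v` and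
total load `a` is assigned `⌈a/2⌉` and `⌊a/2⌋`: if the coin `c s(u,v)` of that edge shows `true`, then
`u` receives `⌈a/2⌉` and `v` receives `⌊a/2⌋`, otherwise it is the other way round.
The division of integers rounds down. -/
def balanceStep {n : ℕ} {G : SimpleGraph (Fin n)} (N : G.Subgraph) (c : Sym2 (Fin n) → Bool)
    (x : Fin n → ℤ) : Fin n → ℤ := fun u =>
  if ∃ v, N.Adj u v then
    if (c s(u, partner N u) = true ↔ u < partner N u) then
      (x u + x (partner N u)) - (x u + x (partner N u)) / 2
    else (x u + x (partner N u)) / 2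
  else x u

/-- The load vector after `s` matchings of the balancing circuit with period `N 0, …, N (d-1)`,
started from the load vector `x₀`; `c (s, e)` is the coin of the edge `e` in step `s`
(steps counted from `0`). -/
def loadAfterSteps {n d : ℕ} [NeZero d] {G : SimpleGraph (Fin n)} (N : Fin d → G.Subgraph)
    (c : ℕ × Sym2 (Fin n) → Bool) (x₀ : Fin n → ℤ) : ℕ → Fin n → ℤ
  | 0 => x₀
  | s + 1 => balanceStep (N (Fin.ofNat d s)) (fun e => c (s, e)) (loadAfterSteps N c x₀ s)

/-- The load vector `x^(t)` at the end of round `t`; a round consists of `d` matchings. -/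
def loadAfterRounds {n d : ℕ} [NeZero d] {G : SimpleGraph (Fin n)} (N : Fin d → G.Subgraph)
    (c : ℕ × Sym2 (Fin n) → Bool) (x₀ : Fin n → ℤ) (t : ℕ) : Fin n → ℤ :=
  loadAfterSteps N c x₀ (t * d)

/-- The discrepancy: maximum load minus minimum load. -/
def disc {n : ℕ} (x : Fin n → ℤ) : ℤ := (⨆ u, x u) - ⨅ u, x u

/-- The expectation `μ` of a distribution on the natural numbers. -/
def mean (D : Measure ℕ) : ℝ := ∫ k, (k : ℝ) ∂D

/-- The standard deviation `σ` of a distribution on the natural numbers. -/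
def stdDev (D : Measure ℕ) : ℝ := √(variance (fun k : ℕ => (k : ℝ)) D)

/-- The distribution `D` on `{0, 1, 2, …}` (with finite expectation and variance) is exponentially
concentrated with constant `κ`. -/
structure ExponentiallyConcentrated (D : Measure ℕ) (κ : ℝ) : Prop where
  memLp : MemLp (fun k : ℕ => (k : ℝ)) 2 D
  tail : ∀ δ : ℝ, 0 < δ →
    D.real {k : ℕ | δ * stdDev D ≤ |(k : ℝ) - mean D|} ≤ Real.exp (-(κ * δ))

/-- The random input of the balancing circuit in the average case: the initial loads `X u` are
independent with distribution `D`, the coins `c (s, e)` are independent and fair, and the coins are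
independent of the initial loads. -/
structure AverageCase {Ω : Type*} [MeasurableSpace Ω] (P : Measure Ω) {n : ℕ} (D : Measure ℕ)
    (X : Fin n → Ω → ℕ) (c : ℕ × Sym2 (Fin n) → Ω → Bool) : Prop where
  measurable_load : ∀ u, Measurable (X u)
  measurable_coin : ∀ p, Measurable (c p)
  law_load : ∀ u, P.map (X u) = D
  fair_coin : ∀ p b, P.real {ω | c p ω = b} = 1 / 2
  indep_load : iIndepFun X P
  indep_coin : iIndepFun c P
  indep_load_coin : IndepFun (fun ω u => X u ω) (fun ω p => c p ω) P

end

end LoadBalancing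

open LoadBalancing

namespace LoadBalancing

/-! Let `A_s` be the averaging operator of step `s`. Without rounding, a linear functional `f` of
the load after `s` steps is the functional `A_0 ⋯ A_{s-1} f` of the initial load, the last matching
acting on `f` first. Take `f = ±(indicator of w - 1/n)`: this measures the deviation of node `w`
from the average load, and two such deviations control the discrepancy.

Rounding: in one step the coins add independent symmetric errors, whose cumulant is at most a
quarter of the drop of `‖f‖²` under that step's averaging. The drops telescope, so all rounding
together is subgaussian with proxy of order `‖f‖² ≤ 1`, whatever `t`; this gives the `√(log n)`
term.

Initial loads: `A_0 ⋯ A_{td-1} f` has sum zero, so `μ` cancels, and the exponential tail of `D`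
bounds the exponential moment in terms of `σ` and the square norm of this vector. That norm is
controlled uniformly in the graph: a one-dimensional Nash inequality, valid on every connected
graph, gives `a_{t+1} ≤ a_t - b a_t³` for the squared norm after `t` rounds, hence `a_t ≤ (b
t)^(-1/2)`. So the vector has length of order `t^(-1/4)`.

The eigenvalue condition enters only through connectedness of the union of the matchings. A Chernoff
bound at level `log n` and a union bound over the `2n` functionals finish the proof. The main lemmas
are `nash_inequality`, `sum_sq_backwardAverage_decay`, `connected_of_secondEigenvalue_lt_one`,
`lintegral_exp_loadAfterSteps_le` and `AverageCase.measureReal_le_exp`. -/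

/-- Averaging of a function along the pairs `{u, p u}`. -/
noncomputable def pairAverage {V : Type*} (p : V → V) (f : V → ℝ) : V → ℝ :=
  fun u => (f u + f (p u)) / 2

/-- The composition `A₀ A₁ ⋯ A_{s-1}` of the pair averages along `p 0, …, p (s-1)`. -/
noncomputable def backwardAverage {V : Type*} (p : ℕ → V → V) : ℕ → (V → ℝ) → V → ℝ
  | 0, f => f
  | s + 1, f => backwardAverage p s (pairAverage (p s) f)

/-! ### Averaging along pairings and decay of the square norm. -/

section Averages

variable {V : Type*} [Fintype V]

theorem sum_comp_involutive {p : V → V} (hp : p.Involutive) (f : V → ℝ) :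
    ∑ u, f (p u) = ∑ u, f u :=
  Equiv.sum_comp hp.toPerm f

theorem sum_pairAverage {p : V → V} (hp : p.Involutive) (f : V → ℝ) :
    ∑ u, pairAverage p f u = ∑ u, f u := by
  simp only [pairAverage, ← Finset.sum_div, Finset.sum_add_distrib, sum_comp_involutive hp]
  ring

theorem sum_abs_pairAverage_le {p : V → V} (hp : p.Involutive) (f : V → ℝ) :
    ∑ u, |pairAverage p f u| ≤ ∑ u, |f u| := by
  have h : ∑ u, |pairAverage p f u| ≤ ∑ u, pairAverage p (fun u => |f u|) u := by
    refine Finset.sum_le_sum fun u _ => ?_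
    simp only [pairAverage, abs_div, abs_two]
    gcongr
    exact abs_add_le _ _
  rwa [sum_pairAverage hp] at h

theorem sum_mul_pairAverage {p : V → V} (hp : p.Involutive) (f g : V → ℝ) :
    ∑ u, f u * pairAverage p g u = ∑ u, pairAverage p f u * g u := by
  have h : ∑ u, f u * g (p u) = ∑ u, f (p u) * g u := by
    rw [← sum_comp_involutive hp]
    simp [hp _]
  have h1 : ∑ u, f u * pairAverage p g u = (∑ u, f u * g u + ∑ u, f u * g (p u)) / 2 := by
    rw [← Finset.sum_add_distrib, Finset.sum_div]
    exact Finset.sum_congr rfl fun u _ => by simp only [pairAverage]; ring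
  have h2 : ∑ u, pairAverage p f u * g u = (∑ u, f u * g u + ∑ u, f (p u) * g u) / 2 := by
    rw [← Finset.sum_add_distrib, Finset.sum_div]
    exact Finset.sum_congr rfl fun u _ => by simp only [pairAverage]; ring
  rw [h1, h2, h]

theorem sum_sq_pairAverage_add {p : V → V} (hp : p.Involutive) (f : V → ℝ) :
    ∑ u, pairAverage p f u ^ 2 + ∑ u, (f u - pairAverage p f u) ^ 2 = ∑ u, f u ^ 2 := by
  have h := sum_comp_involutive hp (fun u => f u ^ 2)
  have h1 : ∑ u, pairAverage p f u ^ 2 + ∑ u, (f u - pairAverage p f u) ^ 2 =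
      (∑ u, f u ^ 2 + ∑ u, f (p u) ^ 2) / 2 := by
    rw [← Finset.sum_add_distrib, ← Finset.sum_add_distrib, Finset.sum_div]
    exact Finset.sum_congr rfl fun u _ => by simp only [pairAverage]; ring
  rw [h1, h]
  ring

theorem sum_sq_pairAverage_le {p : V → V} (hp : p.Involutive) (f : V → ℝ) :
    ∑ u, pairAverage p f u ^ 2 ≤ ∑ u, f u ^ 2 := by
  have h1 := sum_sq_pairAverage_add hp f
  have h2 : 0 ≤ ∑ u, (f u - pairAverage p f u) ^ 2 := Finset.sum_nonneg fun u _ => sq_nonneg _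
  linarith

variable {p : ℕ → V → V}

theorem sum_backwardAverage (hp : ∀ s, (p s).Involutive) (s : ℕ) (f : V → ℝ) :
    ∑ u, backwardAverage p s f u = ∑ u, f u := by
  induction s generalizing f with
  | zero => rfl
  | succ s ih => rw [backwardAverage, ih, sum_pairAverage (hp s)]

theorem sum_abs_backwardAverage_le (hp : ∀ s, (p s).Involutive) (s : ℕ) (f : V → ℝ) :
    ∑ u, |backwardAverage p s f u| ≤ ∑ u, |f u| := by
  induction s generalizing f with
  | zero => rfl
  | succ s ih => exact (ih _).trans (sum_abs_pairAverage_le (hp s) f)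

theorem sum_sq_backwardAverage_le (hp : ∀ s, (p s).Involutive) (s : ℕ) (f : V → ℝ) :
    ∑ u, backwardAverage p s f u ^ 2 ≤ ∑ u, f u ^ 2 := by
  induction s generalizing f with
  | zero => rfl
  | succ s ih => exact (ih _).trans (sum_sq_pairAverage_le (hp s) f)

omit [Fintype V] in
theorem backwardAverage_mul_add {d : ℕ} (hper : ∀ m k, p (m * d + k) = p k) (m k : ℕ)
    (f : V → ℝ) :
    backwardAverage p (m * d + k) f = backwardAverage p (m * d) (backwardAverage p k f) := by
  induction k generalizing f with
  | zero => rfl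
  | succ k ih =>
    rw [← add_assoc, backwardAverage, ih, hper, backwardAverage]

/-- The distance of `f` to each of its averages is controlled by the decrease of the square norm
in the composition of all the averages. -/
theorem sum_sq_sub_pairAverage_le (hp : ∀ s, (p s).Involutive) {i k : ℕ} (hik : i < k)
    (f : V → ℝ) :
    ∑ u, (f u - pairAverage (p i) f u) ^ 2 ≤
      2 ^ k * (∑ u, f u ^ 2 - ∑ u, backwardAverage p k f u ^ 2) := by
  induction k generalizing f with
  | zero => omega
  | succ k ih =>
    rw [backwardAverage]
    set g := pairAverage (p k) f with hg
    have hdrop := sum_sq_pairAverage_add (hp k) f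
    rw [← hg] at hdrop
    have hle := sum_sq_backwardAverage_le hp k g
    have hD : 0 ≤ ∑ u, (f u - g u) ^ 2 := Finset.sum_nonneg fun u _ => sq_nonneg _
    have h2k : (1 : ℝ) ≤ 2 ^ k := one_le_pow₀ (by norm_num)
    rcases Nat.lt_succ_iff_lt_or_eq.1 hik with h | rfl
    -- `I - A_i` does not increase the square norm, so replacing `f` by `g` costs at most `2‖f -
    -- g‖²`, and `‖f - g‖²` is the norm drop of the averaging along `p k`. The factor 2 per
    -- averaging accumulates to `2 ^ k`.
    · have h1 := ih h g
      have h2 := sum_sq_pairAverage_add (hp i) (fun u => f u - g u)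
      have h3 : 0 ≤ ∑ u, pairAverage (p i) (fun u => f u - g u) u ^ 2 :=
        Finset.sum_nonneg fun u _ => sq_nonneg _
      have h4 : ∑ u, (f u - pairAverage (p i) f u) ^ 2 ≤
          2 * ∑ u, (g u - pairAverage (p i) g u) ^ 2 +
          2 * ∑ u, (f u - g u - pairAverage (p i) (fun u => f u - g u) u) ^ 2 := by
        rw [Finset.mul_sum, Finset.mul_sum, ← Finset.sum_add_distrib]
        refine Finset.sum_le_sum fun u _ => ?_
        simp only [pairAverage]
        nlinarith [sq_nonneg ((g u - (g u + g (p i u)) / 2) -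
          (f u - g u - (f u - g u + (f (p i u) - g (p i u))) / 2))]
      have h5 : ∑ u, (f u - g u) ^ 2 ≤ 2 ^ k * ∑ u, (f u - g u) ^ 2 := by nlinarith
      rw [pow_succ]
      nlinarith
    · rw [pow_succ]
      nlinarith

/-- Telescoping along a path: it visits each vertex at most once, so its total variation is at most
the sum over all vertices. -/
theorem abs_sub_le_sum_of_connected {d : ℕ}
    (hconn : (SimpleGraph.fromRel fun u v => ∃ i < d, p i u = v).Connected) (h : V → ℝ)
    (hp : ∀ s, (p s).Involutive) (a b : V) :
    |h a - h b| ≤ ∑ u, ∑ i ∈ Finset.range d, |h u - h (p i u)| := by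
  classical
  set H := SimpleGraph.fromRel fun u v => ∃ i < d, p i u = v with hH
  set F : V → ℝ := fun u => ∑ i ∈ Finset.range d, |h u - h (p i u)| with hF
  have hF0 : ∀ u, 0 ≤ F u := fun u => Finset.sum_nonneg fun i _ => abs_nonneg _
  have hwalk : ∀ {a b : V} (w : H.Walk a b), |h a - h b| ≤ (w.support.map F).sum := by
    intro a b w
    induction w with
    | nil => simpa using hF0 _
    | @cons u v x hadj w ih =>
      rw [SimpleGraph.Walk.support_cons, List.map_cons, List.sum_cons]
      refine (abs_sub_le (h u) (h v) (h x)).trans (add_le_add ?_ ih)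
      obtain ⟨i, hi, hiv⟩ : ∃ i < d, p i u = v := by
        rcases (SimpleGraph.fromRel_adj _ _ _).1 hadj with ⟨_, h | ⟨i, hi, hiv⟩⟩
        · exact h
        · exact ⟨i, hi, by rw [← hiv, hp i v]⟩
      rw [← hiv]
      exact Finset.single_le_sum (f := fun i => |h u - h (p i u)|) (fun i _ => abs_nonneg _)
        (Finset.mem_range.2 hi)
  obtain ⟨w, hw⟩ := hconn.exists_isPath a b
  refine (hwalk w).trans ?_
  rw [← List.sum_toFinset _ hw.support_nodup]
  exact Finset.sum_le_sum_of_subset_of_nonneg (Finset.subset_univ _) fun u _ _ => hF0 u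

theorem abs_mul_abs_sub_le (a b : ℝ) : |a * abs a - b * abs b| ≤ |a - b| * (|a| + |b|) := by
  rcases le_total 0 a with ha | ha <;> rcases le_total 0 b with hb | hb <;>
    rcases le_total a b with hab | hab <;>
    simp only [abs_of_nonneg, abs_of_nonpos, ha, hb, sub_nonneg, sub_nonpos, hab] <;>
    rw [abs_le] <;> constructor <;> nlinarith

/-- A one-dimensional Nash inequality for functions with mean zero on a connected union of
pairings. -/
theorem nash_inequality {d : ℕ}
    (hconn : (SimpleGraph.fromRel fun u v => ∃ i < d, p i u = v).Connected)
    (hp : ∀ s, (p s).Involutive) (z : V → ℝ) (hz : ∑ u, z u = 0) (hz1 : ∑ u, |z u| ≤ 2) :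
    (∑ u, z u ^ 2) ^ 3 ≤ 64 * d * ∑ i ∈ Finset.range d, ∑ u, (z u - z (p i u)) ^ 2 := by
  set S := ∑ i ∈ Finset.range d, ∑ u, (z u - z (p i u)) ^ 2 with hS
  set A := ∑ u, z u ^ 2 with hA
  have hA0 : 0 ≤ A := Finset.sum_nonneg fun u _ => sq_nonneg _
  have hS0 : 0 ≤ S := Finset.sum_nonneg fun i _ => Finset.sum_nonneg fun u _ => sq_nonneg _
  set Q := ∑ u, ∑ i ∈ Finset.range d, |z u * abs (z u) - z (p i u) * abs (z (p i u))| with hQ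
  -- The signed square `z|z|` has differences bounded by `|z a - z b| (|z a| + |z b|)`, so
  -- Cauchy-Schwarz separates the Dirichlet sum `S` from the square norm `A`.
  have hosc : ∀ a b, |z a * abs (z a) - z b * abs (z b)| ≤ Q :=
    abs_sub_le_sum_of_connected hconn (fun u => z u * |z u|) hp
  have hQ2 : Q ^ 2 ≤ S * (4 * d * A) := by
    have h0 : 0 ≤ Q := Finset.sum_nonneg fun i _ => Finset.sum_nonneg fun u _ => abs_nonneg _
    have h1 : Q ≤ ∑ x ∈ Finset.range d ×ˢ (Finset.univ : Finset V),
        |z x.2 - z (p x.1 x.2)| * (|z x.2| + |z (p x.1 x.2)|) := by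
      rw [hQ, Finset.sum_comm, Finset.sum_product]
      exact Finset.sum_le_sum fun i _ => Finset.sum_le_sum fun u _ => abs_mul_abs_sub_le _ _
    refine (pow_le_pow_left₀ h0 h1 2).trans ?_
    refine (Finset.sum_mul_sq_le_sq_mul_sq _ _ _).trans ?_
    rw [Finset.sum_product, Finset.sum_product]
    simp only [sq_abs]
    refine mul_le_mul_of_nonneg_left ?_ hS0
    have h2 : ∀ i, ∑ u, (|z u| + |z (p i u)|) ^ 2 ≤ 4 * A := by
      intro i
      have h3 := sum_comp_involutive (hp i) (fun u => z u ^ 2)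
      have h4 : ∑ u, (|z u| + |z (p i u)|) ^ 2 ≤ 2 * ∑ u, z u ^ 2 + 2 * ∑ u, z (p i u) ^ 2 := by
        rw [Finset.mul_sum, Finset.mul_sum, ← Finset.sum_add_distrib]
        refine Finset.sum_le_sum fun u _ => ?_
        nlinarith [sq_nonneg (|z u| - |z (p i u)|), sq_abs (z u), sq_abs (z (p i u))]
      rw [h3] at h4
      linarith
    refine (Finset.sum_le_sum fun i _ => h2 i).trans (le_of_eq ?_)
    simp
    ring
  obtain ⟨v, hv⟩ : ∃ v, ∀ u, |z u| ≤ |z v| := by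
    have := hconn.nonempty
    exact Finite.exists_max fun u => |z u|
  -- Mean zero supplies a vertex where `z` vanishes or has the opposite sign; the oscillation of
  -- `z|z|` between it and the maximizer `v` is at least `z v ^ 2`.
  have hvQ : z v ^ 2 ≤ Q := by
    have := hconn.nonempty
    rcases le_total 0 (z v) with h0 | h0
    · obtain ⟨b, -, hb⟩ := Finset.exists_le_of_sum_le (s := (Finset.univ : Finset V))
        (f := z) (g := fun _ => 0) Finset.univ_nonempty (by simp [hz])
      have h1 := (le_abs_self _).trans (hosc v b)
      rw [abs_of_nonneg h0] at h1
      nlinarith [abs_nonneg (z b)]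
    · obtain ⟨b, -, hb⟩ := Finset.exists_le_of_sum_le (s := (Finset.univ : Finset V))
        (f := fun _ => 0) (g := z) Finset.univ_nonempty (by simp [hz])
      have h1 := (neg_le_abs _).trans (hosc v b)
      rw [abs_of_nonpos h0] at h1
      nlinarith [abs_nonneg (z b)]
  have hAm : A ≤ 2 * |z v| := by
    have h1 : A ≤ ∑ u, |z u| * |z v| := by
      refine Finset.sum_le_sum fun u _ => ?_
      rw [← sq_abs, sq]
      exact mul_le_mul_of_nonneg_left (hv u) (abs_nonneg _)
    rw [← Finset.sum_mul] at h1
    exact h1.trans (mul_le_mul_of_nonneg_right hz1 (abs_nonneg _))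
  have h4 : A ^ 4 ≤ 64 * d * S * A := by
    calc A ^ 4 ≤ (2 * |z v|) ^ 4 := pow_le_pow_left₀ hA0 hAm 4
      _ = 16 * (z v ^ 2) ^ 2 := by rw [← sq_abs (z v)]; ring
      _ ≤ 16 * Q ^ 2 := by gcongr
      _ ≤ 16 * (S * (4 * d * A)) := by gcongr
      _ = _ := by ring
  rcases hA0.eq_or_lt with h | h
  · rw [← h, zero_pow three_ne_zero]; positivity
  · exact le_of_mul_le_mul_right (by linarith [h4, pow_succ A 3]) h

/-- The norm lost in a round dominates the Dirichlet sum up to `4 d 2^d`; the Nash inequality bounds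
that sum below by a cube. -/
theorem sum_sq_backwardAverage_round_le {d : ℕ} (hd : 0 < d)
    (hconn : (SimpleGraph.fromRel fun u v => ∃ i < d, p i u = v).Connected)
    (hp : ∀ s, (p s).Involutive) (z : V → ℝ) (hz : ∑ u, z u = 0) (hz1 : ∑ u, |z u| ≤ 2) :
    ∑ u, backwardAverage p d z u ^ 2 ≤
      ∑ u, z u ^ 2 - 1 / (256 * d ^ 2 * 2 ^ d) * (∑ u, z u ^ 2) ^ 3 := by
  have h1 := nash_inequality hconn hp z hz hz1
  set E := ∑ u, z u ^ 2 - ∑ u, backwardAverage p d z u ^ 2 with hE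
  have h2 : ∑ i ∈ Finset.range d, ∑ u, (z u - z (p i u)) ^ 2 ≤ d * (4 * (2 ^ d * E)) := by
    have h3 : ∀ i ∈ Finset.range d, ∑ u, (z u - z (p i u)) ^ 2 ≤ 4 * (2 ^ d * E) := by
      intro i hi
      have h4 := sum_sq_sub_pairAverage_le hp (Finset.mem_range.1 hi) z
      have h5 : ∑ u, (z u - z (p i u)) ^ 2 = 4 * ∑ u, (z u - pairAverage (p i) z u) ^ 2 := by
        rw [Finset.mul_sum]
        exact Finset.sum_congr rfl fun u _ => by simp only [pairAverage]; ring
      linarith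
    simpa using Finset.sum_le_sum h3
  have hd' : (0 : ℝ) < d := by exact_mod_cast hd
  have h6 : (∑ u, z u ^ 2) ^ 3 ≤ 256 * d ^ 2 * 2 ^ d * E := by
    calc _ ≤ _ := h1
      _ ≤ 64 * d * (d * (4 * (2 ^ d * E))) := by gcongr
      _ = _ := by ring
  have h7 : 1 / (256 * d ^ 2 * 2 ^ d) * (∑ u, z u ^ 2) ^ 3 ≤ E := by
    rw [one_div, inv_mul_le_iff₀ (by positivity)]
    exact h6
  linarith

/-- Discrete analogue of `a' = -c a³`, whose solutions decay like `(c t)^(-1/2)`. With `q = c a²`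
the induction step reduces to `(1 - q)² (1 + q) ≤ 1`. -/
theorem sq_mul_le_one_of_le_sub_cube {a b c t : ℝ} (hc : 0 ≤ c) (hb : 0 ≤ b)
    (ha : 0 ≤ a) (hab : b ≤ a - c * a ^ 3) (hat : a ^ 2 * (c * t) ≤ 1) :
    b ^ 2 * (c * (t + 1)) ≤ 1 := by
  rcases ha.eq_or_lt with rfl | ha
  · have : b = 0 := by nlinarith
    simp [this]
  · set q := c * a ^ 2 with hq
    have hq0 : 0 ≤ q := by positivity
    have hb' : b ≤ a * (1 - q) := by rw [hq]; linarith [pow_succ a 2]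
    have hq1 : q ≤ 1 := by
      by_contra! h
      nlinarith
    rcases le_total (t + 1) 0 with ht | ht
    · nlinarith [mul_nonneg (sq_nonneg b) hc]
    · have h1 : b ^ 2 ≤ (a * (1 - q)) ^ 2 := pow_le_pow_left₀ hb hb' 2
      calc b ^ 2 * (c * (t + 1)) ≤ (a * (1 - q)) ^ 2 * (c * (t + 1)) := by gcongr
        _ = (1 - q) ^ 2 * (a ^ 2 * (c * t) + q) := by rw [hq]; ring
        _ ≤ (1 - q) ^ 2 * (1 + q) := by gcongr
        _ = (1 - q) * (1 - q ^ 2) := by ring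
        _ ≤ 1 * 1 := by
          apply mul_le_mul <;> nlinarith
        _ = 1 := one_mul 1

/-- Polynomial decay of the square norm, uniformly in the graph. -/
theorem sum_sq_backwardAverage_decay {d : ℕ} (hd : 0 < d)
    (hconn : (SimpleGraph.fromRel fun u v => ∃ i < d, p i u = v).Connected)
    (hp : ∀ s, (p s).Involutive) (hper : ∀ m k, p (m * d + k) = p k) (t : ℕ) (z : V → ℝ)
    (hz : ∑ u, z u = 0) (hz1 : ∑ u, |z u| ≤ 2) :
    (∑ u, backwardAverage p (t * d) z u ^ 2) ^ 2 * (1 / (256 * d ^ 2 * 2 ^ d) * t) ≤ 1 := by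
  -- By definition the new round acts on `z` first. By periodicity all rounds are the same operator,
  -- so it can equally be applied last, to the vector already averaged.
  have hcomm : ∀ t : ℕ, backwardAverage p ((t + 1) * d) z =
      backwardAverage p d (backwardAverage p (t * d) z) := by
    intro t
    have : ∀ t : ℕ, backwardAverage p (t * d) = (backwardAverage p d)^[t] := by
      intro t
      induction t with
      | zero => funext f; simp [backwardAverage]
      | succ t ih =>
        funext f
        rw [add_mul, one_mul, backwardAverage_mul_add hper, ih, Function.iterate_succ_apply]
    rw [this, this, Function.iterate_succ_apply']
  induction t with
  | zero => simp
  | succ t ih =>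
    rw [hcomm, Nat.cast_succ]
    refine sq_mul_le_one_of_le_sub_cube (by positivity)
      (Finset.sum_nonneg fun u _ => sq_nonneg _) (Finset.sum_nonneg fun u _ => sq_nonneg _)
      (sum_sq_backwardAverage_round_le hd hconn hp _ ?_ ?_) ih
    · rw [sum_backwardAverage hp, hz]
    · exact (sum_abs_backwardAverage_le hp _ _).trans hz1

end Averages

/-! ### Matching matrices as pair averages. -/

section Partner

variable {n : ℕ} {G : SimpleGraph (Fin n)} {N : G.Subgraph}

theorem partner_eq_of_adj (hN : N.IsMatching) {u v : Fin n} (h : N.Adj u v) :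
    partner N u = v := by
  have hex : ∃ v, N.Adj u v := ⟨v, h⟩
  rw [partner, dif_pos hex]
  exact (hN (N.edge_vert h)).unique hex.choose_spec h

theorem partner_eq_self {u : Fin n} (h : ¬ ∃ v, N.Adj u v) : partner N u = u := by
  rw [partner, dif_neg h]

theorem partner_involutive (hN : N.IsMatching) : (partner N).Involutive := by
  intro u
  by_cases h : ∃ v, N.Adj u v
  · obtain ⟨v, hv⟩ := h
    rw [partner_eq_of_adj hN hv, partner_eq_of_adj hN hv.symm]
  · rw [partner_eq_self h, partner_eq_self h]

theorem partner_ne_self_iff (hN : N.IsMatching) {u : Fin n} :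
    partner N u ≠ u ↔ ∃ v, N.Adj u v := by
  refine ⟨fun h => by_contra fun h' => h (partner_eq_self h'), ?_⟩
  rintro ⟨v, hv⟩
  rw [partner_eq_of_adj hN hv]
  exact hv.ne.symm

theorem matchingMatrix_mulVec (hN : N.IsMatching) (f : Fin n → ℝ) :
    Matrix.mulVec (matchingMatrix N) f = pairAverage (partner N) f := by
  classical
  ext u
  simp only [Matrix.mulVec, dotProduct, matchingMatrix, Matrix.of_apply, pairAverage]
  by_cases h : ∃ w, N.Adj u w
  · obtain ⟨v, hv⟩ := h
    have hne : u ≠ v := hv.ne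
    have hadj : ∀ x, N.Adj u x ↔ v = x := fun x =>
      ⟨fun hx => (partner_eq_of_adj hN hv).symm.trans (partner_eq_of_adj hN hx),
        fun hx => hx ▸ hv⟩
    rw [partner_eq_of_adj hN hv]
    simp only [hadj, exists_eq', if_true]
    have h1 : ∀ x, (if u = x ∨ v = x then (1 / 2 : ℝ) else 0) * f x =
        (if u = x then f x / 2 else 0) + (if v = x then f x / 2 else 0) := by
      intro x
      by_cases h1 : u = x
      · have h2 : v ≠ x := fun h2 => hne (h1.trans h2.symm)
        simp [h1, h2]; ring
      · by_cases h2 : v = x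
        · simp [h1, h2]; ring
        · simp [h1, h2]
    simp only [h1, Finset.sum_add_distrib, Finset.sum_ite_eq, Finset.mem_univ, if_true]
    ring
  · rw [partner_eq_self h]
    simp [h]

theorem matchingMatrix_transpose (N : G.Subgraph) :
    (matchingMatrix N).transpose = matchingMatrix N := by
  ext u v
  simp only [Matrix.transpose_apply, matchingMatrix, Matrix.of_apply]
  by_cases huv : u = v
  · rw [huv]
  · by_cases h : N.Adj u v
    · have h1 : ∃ w, N.Adj u w := ⟨v, h⟩
      have h2 : ∃ w, N.Adj v w := ⟨u, h.symm⟩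
      simp [h, h.symm, h1, h2]
    · have h' : ¬ N.Adj v u := fun hh => h hh.symm
      simp [h, h', huv, Ne.symm huv]

end Partner

/-! ### From the eigenvalue condition to connectedness. -/

theorem prod_mulVec_eq_self {ι : Type*} [Fintype ι] [DecidableEq ι] (f : ι → ℝ)
    (l : List (Matrix ι ι ℝ))
    (h : ∀ A ∈ l, Matrix.mulVec A f = f ∧ Matrix.vecMul f A = f) :
    Matrix.mulVec l.prod f = f ∧ Matrix.vecMul f l.prod = f := by
  induction l with
  | nil => simp
  | cons A l ih =>
    obtain ⟨h1, h2⟩ := ih fun B hB => h B (List.mem_cons_of_mem _ hB)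
    obtain ⟨h3, h4⟩ := h A List.mem_cons_self
    rw [List.prod_cons, ← Matrix.mulVec_mulVec, ← Matrix.vecMul_vecMul, h1, h4]
    exact ⟨h3, h2⟩

theorem le_secondLargest {s : Multiset ℝ} {a : ℝ} (h : 2 ≤ s.countP (a ≤ ·)) :
    a ≤ secondLargest s := by
  rw [secondLargest]
  have hs := s.pairwise_sort (· ≥ ·)
  rw [← s.sort_eq (· ≥ ·), Multiset.coe_countP] at h
  generalize s.sort (· ≥ ·) = l at h hs
  match l, h, hs with
  | [], h, _ => simp at h
  | [x], h, _ =>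
    have := h.trans List.countP_le_length
    simp at this
  | x :: y :: l, h, hs =>
    simp only [List.getD_cons_succ, List.getD_cons_zero]
    by_contra! hy
    have h0 : (y :: l).countP (a ≤ ·) = 0 := by
      rw [List.countP_eq_zero]
      intro z hz
      have : z ≤ y := by
        rcases List.mem_cons.1 hz with rfl | hz
        · exact le_rfl
        · exact (List.pairwise_cons.1 (List.pairwise_cons.1 hs).2).1 z hz
      simpa using this.trans_lt hy
    rw [List.countP_cons, h0] at h
    split_ifs at h <;> omega

/-- Two nonzero orthogonal fixed vectors of a symmetric matrix force the eigenvalue `1` to have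
multiplicity at least two. -/
theorem two_le_count_roots_charpoly {ι : Type*} [Fintype ι] [DecidableEq ι] {A : Matrix ι ι ℝ}
    (hA : A.IsHermitian) {v w : ι → ℝ} (hv : Matrix.mulVec A v = v) (hw : Matrix.mulVec A w = w)
    (hv0 : v ≠ 0) (hw0 : w ≠ 0) (hvw : v ⬝ᵥ w = 0) :
    2 ≤ A.charpoly.roots.count 1 := by
  classical
  rw [hA.roots_charpoly_eq_eigenvalues]
  set b := hA.eigenvectorBasis with hb
  have hcoef : ∀ x : ι → ℝ, Matrix.mulVec A x = x → ∀ i, hA.eigenvalues i ≠ 1 →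
      inner ℝ (b i) (WithLp.toLp 2 x) = 0 := by
    intro x hx i hi
    have h1 := hA.mulVec_eigenvectorBasis i
    have h2 : (b i).ofLp ⬝ᵥ x = hA.eigenvalues i * ((b i).ofLp ⬝ᵥ x) := by
      conv_lhs => rw [← hx]
      rw [Matrix.dotProduct_mulVec, ← Matrix.mulVec_transpose]
      have : A.transpose = A := by simpa [Matrix.IsHermitian] using hA
      rw [this, h1, smul_dotProduct, smul_eq_mul]
    have h3 : (b i).ofLp ⬝ᵥ x = 0 := by
      by_contra h
      exact hi (mul_right_cancel₀ h (by rw [one_mul]; exact h2.symm))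
    rw [EuclideanSpace.inner_eq_star_dotProduct]
    simpa [dotProduct_comm] using h3
  have hinner : ∑ i, inner ℝ (WithLp.toLp 2 v) (b i) * inner ℝ (b i) (WithLp.toLp 2 w) = 0 := by
    rw [b.sum_inner_mul_inner, EuclideanSpace.inner_eq_star_dotProduct]
    simpa [dotProduct_comm] using hvw
  have hex : ∀ x : ι → ℝ, Matrix.mulVec A x = x → x ≠ 0 →
      ∃ i, inner ℝ (b i) (WithLp.toLp 2 x) ≠ 0 := by
    intro x _ hx0
    by_contra! h
    apply hx0
    have h1 : WithLp.toLp 2 x = (0 : EuclideanSpace ℝ ι) := by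
      rw [← b.sum_repr' (WithLp.toLp 2 x)]
      simp [h]
    simpa using congrArg WithLp.ofLp h1
  obtain ⟨i, hi⟩ := hex v hv hv0
  obtain ⟨j, hj⟩ := hex w hw hw0
  have hi1 : hA.eigenvalues i = 1 := by_contra fun h => hi (hcoef v hv i h)
  have hj1 : hA.eigenvalues j = 1 := by_contra fun h => hj (hcoef w hw j h)
  -- If `i` were the only index with eigenvalue 1, the inner product of `v` and `w` would reduce to
  -- its `i`-th term in the eigenbasis, a product of nonzero coefficients.
  obtain ⟨k, hk, hk1⟩ : ∃ k, k ≠ i ∧ hA.eigenvalues k = 1 := by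
    by_contra! h
    have hji : j = i := by_contra fun hji => h j hji hj1
    rw [Finset.sum_eq_single i] at hinner
    · rw [real_inner_comm] at hinner
      rcases mul_eq_zero.1 hinner with h0 | h0
      · exact hi h0
      · exact hj (hji ▸ h0)
    · intro k _ hk
      rw [hcoef w hw k (h k hk), mul_zero]
    · simp
  rw [Multiset.count_map]
  have : ({i, k} : Finset ι).card ≤
      (Finset.univ.filter fun x => 1 = hA.eigenvalues x).card := by
    apply Finset.card_le_card
    intro x hx
    rcases Finset.mem_insert.1 hx with rfl | hx
    · simp [hi1]
    · rw [Finset.mem_singleton.1 hx]; simp [hk1]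
  rw [Finset.card_pair hk.symm] at this
  simpa [Finset.card] using this

/-- If the union of the matchings were disconnected, the indicators of a component and of its
complement would be fixed by every matching matrix, from both sides since these are symmetric. Hence
`M` and `M Mᵀ` fix both, and the eigenvalue 1 is at least double in either branch of the definition.
-/
theorem connected_of_secondEigenvalue_lt_one {n d : ℕ} [NeZero n] [NeZero d]
    {G : SimpleGraph (Fin n)} {N : Fin d → G.Subgraph} (hN : ∀ i, (N i).IsMatching)
    (hlam : secondEigenvalue (roundMatrix N) < 1) :
    (SimpleGraph.fromRel fun u v => ∃ i < d, partner (N (Fin.ofNat d i)) u = v).Connected := by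
  classical
  rw [SimpleGraph.connected_iff]
  refine ⟨?_, ⟨0⟩⟩
  by_contra hpre
  set H := SimpleGraph.fromRel fun u v => ∃ i < d, partner (N (Fin.ofNat d i)) u = v with hH
  obtain ⟨a, b, hab⟩ : ∃ a b, ¬ H.Reachable a b := by
    simpa [SimpleGraph.Preconnected] using hpre
  have hclosed : ∀ (i : Fin d) u, H.Reachable a (partner (N i) u) ↔ H.Reachable a u := by
    intro i u
    by_cases h : partner (N i) u = u
    · rw [h]
    · have hadj : H.Adj u (partner (N i) u) := by
        rw [hH, SimpleGraph.fromRel_adj]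
        exact ⟨Ne.symm h, Or.inl ⟨i, i.2, by simp⟩⟩
      exact ⟨fun hr => hr.trans hadj.symm.reachable, fun hr => hr.trans hadj.reachable⟩
  set v : Fin n → ℝ := fun u => if H.Reachable a u then 1 else 0 with hv
  set w : Fin n → ℝ := fun u => if H.Reachable a u then 0 else 1 with hw
  have hfix : ∀ f : Fin n → ℝ, (∀ i u, f (partner (N i) u) = f u) →
      Matrix.mulVec (roundMatrix N) f = f ∧ Matrix.vecMul f (roundMatrix N) = f := by
    intro f hf
    refine prod_mulVec_eq_self f _ fun A hA => ?_
    obtain ⟨i, rfl⟩ := (List.mem_ofFn' _ _).1 hA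
    have h1 : Matrix.mulVec (matchingMatrix (N i)) f = f := by
      rw [matchingMatrix_mulVec (hN i)]
      ext u
      rw [pairAverage, hf]
      ring
    exact ⟨h1, by rw [← Matrix.mulVec_transpose, matchingMatrix_transpose, h1]⟩
  obtain ⟨hv1, hv2⟩ := hfix v fun i u => by simp only [hv, hclosed]
  obtain ⟨hw1, hw2⟩ := hfix w fun i u => by simp only [hw, hclosed]
  have hv0 : v ≠ 0 := fun h => by simpa [hv] using congrFun h a
  have hw0 : w ≠ 0 := fun h => by simpa [hw, hab] using congrFun h b
  have hvw : v ⬝ᵥ w = 0 := by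
    refine Finset.sum_eq_zero fun u _ => ?_
    by_cases h : H.Reachable a u <;> simp [hv, hw, h]
  refine absurd hlam (not_lt.2 ?_)
  rw [secondEigenvalue]
  split_ifs with hsymm
  · have h2 := two_le_count_roots_charpoly (A := roundMatrix N)
      (by simpa [Matrix.IsHermitian, Matrix.IsSymm] using hsymm) hv1 hw1 hv0 hw0 hvw
    apply le_secondLargest
    rw [Multiset.countP_map]
    refine h2.trans ?_
    rw [Multiset.count, Multiset.countP_eq_card_filter]
    refine Multiset.card_le_card (Multiset.monotone_filter_right _ ?_)
    rintro x rfl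
    simp
  · have h2 := two_le_count_roots_charpoly (A := roundMatrix N * (roundMatrix N).transpose)
      (v := v) (w := w) (by
        rw [Matrix.IsHermitian, Matrix.conjTranspose_mul]
        simp)
      (by rw [← Matrix.mulVec_mulVec, Matrix.mulVec_transpose, hv2, hv1])
      (by rw [← Matrix.mulVec_mulVec, Matrix.mulVec_transpose, hw2, hw1]) hv0 hw0 hvw
    apply le_secondLargest
    refine h2.trans ?_
    rw [Multiset.count, Multiset.countP_eq_card_filter, Multiset.countP_eq_card_filter]
    refine Multiset.card_le_card (Multiset.monotone_filter_right _ ?_)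
    rintro x rfl
    exact le_rfl

/-! ### Rounding errors of a single matching. -/

section CoinStep

variable {n : ℕ} {G : SimpleGraph (Fin n)} {N : G.Subgraph}

/-- The rounding errors of one step are odd along the matched pairs. -/
theorem balanceStep_eq (hN : N.IsMatching) (b : Sym2 (Fin n) → Bool) (x : Fin n → ℤ)
    (u : Fin n) :
    (balanceStep N b x u : ℝ) = pairAverage (partner N) (fun v => (x v : ℝ)) u +
      (if b s(u, partner N u) = true then 1 else -1) *
        (((x u + x (partner N u)) % 2 : ℤ) / 2) *
        ((if u < partner N u then 1 else 0) - if partner N u < u then 1 else 0) := by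
  rw [balanceStep]
  by_cases h : ∃ v, N.Adj u v
  · have hne := (partner_ne_self_iff hN).2 h
    have hdiv : (((x u + x (partner N u)) % 2 : ℤ) : ℝ) +
        2 * (((x u + x (partner N u)) / 2 : ℤ) : ℝ) = x u + x (partner N u) := by
      exact_mod_cast Int.emod_add_mul_ediv (x u + x (partner N u)) 2
    rw [if_pos h]
    rcases lt_or_gt_of_ne hne with hlt | hlt <;>
      by_cases hb : b s(u, partner N u) = true <;>
      simp only [hb, hlt, hlt.not_gt, if_true, if_false, iff_self, iff_false, iff_true,
        Bool.false_eq_true, not_true, pairAverage] <;>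
      push_cast <;> linarith
  · simp [h, pairAverage, partner_eq_self h]

/-- Indexing the error by the smaller endpoint of each pair makes every coin occur exactly once, as
independence requires. -/
theorem sum_mul_balanceStep (hN : N.IsMatching) (b : Sym2 (Fin n) → Bool) (x : Fin n → ℤ)
    (f : Fin n → ℝ) :
    ∑ u, f u * balanceStep N b x u = ∑ u, pairAverage (partner N) f u * x u +
      ∑ u : {u // u < partner N u}, (if b s(u.1, partner N u.1) = true then 1 else -1) *
        ((((x u + x (partner N u.1)) % 2 : ℤ) / 2) * (f u - f (partner N u.1))) := by
  have hp := partner_involutive hN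
  set p := partner N with hpdef
  have h1 : ∀ g : Fin n → ℝ, ∑ u : {u // u < p u}, g u = ∑ u, if u < p u then g u else 0 := by
    intro g
    rw [← Finset.sum_filter]
    exact (Finset.sum_subtype _ (by simp) g).symm
  rw [h1 fun u => (if b s(u, p u) = true then 1 else -1) *
        ((((x u + x (p u)) % 2 : ℤ) / 2) * (f u - f (p u))), ← sum_mul_pairAverage hp f]
  simp only [balanceStep_eq hN, ← hpdef, mul_add, Finset.sum_add_distrib]
  congr 1
  set k : Fin n → ℝ := fun u => (if b s(u, p u) = true then 1 else -1) *
        (((x u + x (p u)) % 2 : ℤ) / 2) with hk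
  have hkp : ∀ u, k (p u) = k u := by
    intro u
    simp only [hk, hp u, Sym2.eq_swap (a := p u) (b := u), add_comm (x (p u))]
  have h2 : ∑ u, (if p u < u then f u * k u else 0) =
      ∑ u, if u < p u then f (p u) * k u else 0 := by
    rw [← sum_comp_involutive hp]
    simp only [hp _, hkp]
  calc _ = ∑ u, ((if u < p u then f u * k u else 0) - if p u < u then f u * k u else 0) := by
        refine Finset.sum_congr rfl fun u _ => ?_
        simp only [hk]
        split_ifs <;> ring
    _ = ∑ u, ((if u < p u then f u * k u else 0) - if u < p u then f (p u) * k u else 0) := by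
        rw [Finset.sum_sub_distrib, h2, ← Finset.sum_sub_distrib]
    _ = _ := by
        refine Finset.sum_congr rfl fun u _ => ?_
        simp only [hk]
        by_cases h : u < p u
        · simp only [h, if_true]
          ring
        · simp only [h, if_false, sub_zero]

theorem lintegral_exp_fair_coin_le {Ω : Type*} [MeasurableSpace Ω] {P : Measure Ω}
    [IsProbabilityMeasure P] {c : Ω → Bool} (hc : Measurable c)
    (hfair : ∀ b, P.real {ω | c ω = b} = 1 / 2) (a : ℝ) :
    ∫⁻ ω, ENNReal.ofReal (Real.exp ((if c ω = true then 1 else -1) * a)) ∂P ≤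
      ENNReal.ofReal (Real.exp (a ^ 2 / 2)) := by
  have h1 : ∀ b, P.map c {b} = ENNReal.ofReal (1 / 2) := by
    intro b
    rw [Measure.map_apply hc (measurableSet_singleton b), ← hfair b, measureReal_def,
      ENNReal.ofReal_toReal (measure_ne_top _ _)]
    rfl
  rw [← lintegral_map (f := fun b : Bool => ENNReal.ofReal (Real.exp ((if b = true then 1 else -1) * a)))
    (measurable_of_countable _) hc, lintegral_fintype, Fintype.sum_bool, h1, h1,
    ← ENNReal.ofReal_mul (Real.exp_nonneg _), ← ENNReal.ofReal_mul (Real.exp_nonneg _),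
    ← ENNReal.ofReal_add (by positivity) (by positivity)]
  refine ENNReal.ofReal_le_ofReal (le_trans (le_of_eq ?_) (Real.cosh_le_exp_half_sq a))
  rw [Real.cosh_eq]
  simp
  ring

/-- A pair contributes a fair sign times at most `|f u - f (p u)| / 2`, so an exponent of at most
`(f u - f (p u))² / 8`, while its two nodes lose `(f u - f (p u))² / 2` of the square norm: hence
the factor `1/4`. -/
theorem lintegral_exp_balanceStep_le {Ω : Type*} [MeasurableSpace Ω] {P : Measure Ω}
    [IsProbabilityMeasure P] {c : Sym2 (Fin n) → Ω → Bool} (hc : ∀ e, Measurable (c e))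
    (hfair : ∀ e b, P.real {ω | c e ω = b} = 1 / 2) (hind : iIndepFun c P)
    (hN : N.IsMatching) (x : Fin n → ℤ) (f : Fin n → ℝ) :
    ∫⁻ ω, ENNReal.ofReal (Real.exp (∑ u, f u * balanceStep N (fun e => c e ω) x u)) ∂P ≤
      ENNReal.ofReal (Real.exp (∑ u, pairAverage (partner N) f u * x u +
        (∑ u, f u ^ 2 - ∑ u, pairAverage (partner N) f u ^ 2) / 4)) := by
  have hp := partner_involutive hN
  set p := partner N with hpdef
  set a : {u // u < p u} → ℝ := fun u =>
    (((x u + x (p u.1)) % 2 : ℤ) / 2) * (f u - f (p u.1)) with ha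
  have hinj : Function.Injective fun u : {u // u < p u} => s(u.1, p u.1) := by
    rintro ⟨u, hu⟩ ⟨v, hv⟩ h
    rcases Sym2.eq_iff.1 h with ⟨h1, -⟩ | ⟨h1, h2⟩
    · exact Subtype.ext h1
    · simp only at h1 h2
      rw [h1] at h2 hu
      rw [h2] at hu
      exact absurd hu hv.not_gt
  have hind2 : iIndepFun (fun (u : {u // u < p u}) ω =>
      ENNReal.ofReal (Real.exp ((if c s(u.1, p u.1) ω = true then 1 else -1) * a u))) P :=
    (hind.precomp hinj).comp
      (fun u b => ENNReal.ofReal (Real.exp ((if b = true then 1 else -1) * a u)))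
      fun u => measurable_of_countable _
  have hmeas : ∀ u : {u // u < p u}, Measurable fun ω =>
      ENNReal.ofReal (Real.exp ((if c s(u.1, p u.1) ω = true then 1 else -1) * a u)) := fun u =>
    (measurable_of_countable fun b : Bool =>
      ENNReal.ofReal (Real.exp ((if b = true then 1 else -1) * a u))).comp (hc _)
  have hsum : ∑ u, a u ^ 2 / 2 ≤ (∑ u, f u ^ 2 - ∑ u, pairAverage p f u ^ 2) / 4 := by
    have h1 : ∀ u, a u ^ 2 ≤ (f u - pairAverage p f u) ^ 2 := by
      intro u
      have h0 : (((x u + x (p u.1)) % 2 : ℤ) : ℝ) ^ 2 ≤ 1 := by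
        rcases Int.emod_two_eq (x u + x (p u.1)) with h | h <;> simp [h]
      have : (f u - pairAverage p f u) ^ 2 = (f u - f (p u)) ^ 2 / 4 := by
        simp only [pairAverage]; ring
      rw [this, ha]
      nlinarith [sq_nonneg (f u - f (p u.1))]
    have h2 : ∑ u : {u // u < p u}, (f u - pairAverage p f u) ^ 2 =
        ∑ u, if u < p u then (f u - pairAverage p f u) ^ 2 else 0 := by
      rw [← Finset.sum_filter]
      exact (Finset.sum_subtype _ (by simp) fun u => (f u - pairAverage p f u) ^ 2).symm
    have h3 : ∑ u, (if p u < u then (f u - pairAverage p f u) ^ 2 else 0) =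
        ∑ u, if u < p u then (f u - pairAverage p f u) ^ 2 else 0 := by
      rw [← sum_comp_involutive hp]
      refine Finset.sum_congr rfl fun u _ => ?_
      simp only [hp u, pairAverage]
      congr 1
      ring
    have h4 : ∑ u, (if u < p u then (f u - pairAverage p f u) ^ 2 else 0) +
        ∑ u, (if p u < u then (f u - pairAverage p f u) ^ 2 else 0) ≤
        ∑ u, (f u - pairAverage p f u) ^ 2 := by
      rw [← Finset.sum_add_distrib]
      refine Finset.sum_le_sum fun u _ => ?_
      have := sq_nonneg (f u - pairAverage p f u)
      rcases lt_trichotomy u (p u) with h | h | h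
      · simp [h, h.not_gt]
      · simp [← h]; exact this
      · simp [h, h.not_gt]
    have h5 := sum_sq_pairAverage_add hp f
    have h6 := Finset.sum_le_sum fun u (_ : u ∈ Finset.univ) => h1 u
    rw [← Finset.sum_div]
    linarith
  calc _ = ∫⁻ ω, ENNReal.ofReal (Real.exp (∑ u, pairAverage p f u * x u)) *
        ∏ u : {u // u < p u},
          ENNReal.ofReal (Real.exp ((if c s(u.1, p u.1) ω = true then 1 else -1) * a u)) ∂P := by
        refine lintegral_congr fun ω => ?_
        rw [sum_mul_balanceStep hN, Real.exp_add, ENNReal.ofReal_mul (Real.exp_nonneg _)]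
        congr 1
        rw [Real.exp_sum, ENNReal.ofReal_prod_of_nonneg fun _ _ => Real.exp_nonneg _]
    _ = ENNReal.ofReal (Real.exp (∑ u, pairAverage p f u * x u)) *
        ∏ u : {u // u < p u}, ∫⁻ ω,
          ENNReal.ofReal (Real.exp ((if c s(u.1, p u.1) ω = true then 1 else -1) * a u)) ∂P := by
        rw [lintegral_const_mul _ (by fun_prop), lintegral_prod_eq_prod_lintegral_of_indepFun _ _
          hind2 hmeas]
    _ ≤ ENNReal.ofReal (Real.exp (∑ u, pairAverage p f u * x u)) *
        ∏ u : {u // u < p u}, ENNReal.ofReal (Real.exp (a u ^ 2 / 2)) := by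
        gcongr with u
        exact lintegral_exp_fair_coin_le (hc _) (hfair _) _
    _ ≤ _ := by
        rw [← ENNReal.ofReal_prod_of_nonneg fun _ _ => Real.exp_nonneg _, ← Real.exp_sum,
          ← ENNReal.ofReal_mul (Real.exp_nonneg _), ← Real.exp_add]
        exact ENNReal.ofReal_le_ofReal (Real.exp_le_exp.2 (by linarith))

end CoinStep

/-- Stands in for conditioning on `Y`: by Fubini, a bound for each frozen value of `Y` can be
integrated. -/
theorem lintegral_le_lintegral_of_indepFun {Ω α β : Type*} [MeasurableSpace Ω]
    [MeasurableSpace α] [MeasurableSpace β] {P : Measure Ω} [IsProbabilityMeasure P]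
    {Y : Ω → α} {Z : Ω → β} (hYZ : IndepFun Y Z P) (hY : Measurable Y) (hZ : Measurable Z)
    {H : α → β → ENNReal} (hH : Measurable (Function.uncurry H)) {F : α → ENNReal}
    (hF : Measurable F) (h : ∀ y, ∫⁻ ω, H y (Z ω) ∂P ≤ F y) :
    ∫⁻ ω, H (Y ω) (Z ω) ∂P ≤ ∫⁻ ω, F (Y ω) ∂P := by
  have hmap := (indepFun_iff_map_prod_eq_prod_map_map hY.aemeasurable hZ.aemeasurable).1 hYZ
  have := Measure.isProbabilityMeasure_map (μ := P) hZ.aemeasurable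
  calc _ = ∫⁻ q, Function.uncurry H q ∂(P.map fun ω => (Y ω, Z ω)) := by
        rw [lintegral_map hH (hY.prodMk hZ)]
        rfl
    _ = ∫⁻ y, ∫⁻ z, H y z ∂(P.map Z) ∂(P.map Y) := by
        rw [hmap, lintegral_prod _ hH.aemeasurable]
        rfl
    _ ≤ ∫⁻ y, F y ∂(P.map Y) := by
        refine lintegral_mono fun y => ?_
        rw [lintegral_map (f := H y) (hH.comp measurable_prodMk_left) hZ]
        exact h y
    _ = _ := lintegral_map hF hY

/-! ### Accumulated rounding errors for fixed initial loads. -/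

section Steps

variable {n d : ℕ} [NeZero d] {G : SimpleGraph (Fin n)} {N : Fin d → G.Subgraph}

theorem loadAfterSteps_congr {c c' : ℕ × Sym2 (Fin n) → Bool} (x₀ : Fin n → ℤ) {s : ℕ}
    (h : ∀ q : ℕ × Sym2 (Fin n), q.1 < s → c q = c' q) :
    loadAfterSteps N c x₀ s = loadAfterSteps N c' x₀ s := by
  induction s with
  | zero => rfl
  | succ s ih =>
    rw [loadAfterSteps, loadAfterSteps, ih fun q hq => h q (hq.trans (Nat.lt_succ_self s))]
    congr 1
    funext e
    exact h (s, e) (Nat.lt_succ_self s)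

/-- The load after `s` steps is a function of the finitely many coins of these steps. -/
theorem loadAfterSteps_eq_restrict (x₀ : Fin n → ℤ) (s : ℕ) :
    ∃ Φ : ((Finset.range s ×ˢ (Finset.univ : Finset (Sym2 (Fin n)))) → Bool) → Fin n → ℤ,
      ∀ c : ℕ × Sym2 (Fin n) → Bool, loadAfterSteps N c x₀ s = Φ fun q => c q := by
  classical
  -- The default `false` is harmless: coins outside the finite set are never read in the first `s`
  -- steps.
  refine ⟨fun r => loadAfterSteps N (fun q =>
    if h : q ∈ Finset.range s ×ˢ (Finset.univ : Finset (Sym2 (Fin n))) then r ⟨q, h⟩ else false)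
    x₀ s, fun c => loadAfterSteps_congr _ fun q hq => ?_⟩
  simp [hq]

theorem measurable_loadAfterSteps (x₀ : Fin n → ℤ) (s : ℕ) :
    Measurable fun c : ℕ × Sym2 (Fin n) → Bool => loadAfterSteps N c x₀ s := by
  obtain ⟨Φ, hΦ⟩ := loadAfterSteps_eq_restrict (N := N) x₀ s
  simp only [hΦ]
  exact (measurable_of_countable Φ).comp (by fun_prop)

theorem measurable_comp_loadAfterSteps {β : Type*} [MeasurableSpace β] (φ : (Fin n → ℤ) → β)
    (s : ℕ) :
    Measurable (Function.uncurry fun (y : Fin n → ℕ) (c : ℕ × Sym2 (Fin n) → Bool) =>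
      φ (loadAfterSteps N c (fun u => (y u : ℤ)) s)) := by
  refine measurable_from_prod_countable_right fun y => ?_
  exact (measurable_of_countable φ).comp (measurable_loadAfterSteps (fun u => (y u : ℤ)) s)

variable {Ω : Type*} [MeasurableSpace Ω] {P : Measure Ω} [IsProbabilityMeasure P]
  {c : ℕ × Sym2 (Fin n) → Ω → Bool}

omit [IsProbabilityMeasure P] in
theorem indepFun_loadAfterSteps_coin (hc : ∀ q, Measurable (c q)) (hind : iIndepFun c P)
    (x₀ : Fin n → ℤ) (s : ℕ) :
    IndepFun (fun ω => loadAfterSteps N (fun q => c q ω) x₀ s) (fun ω e => c (s, e) ω) P := by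
  classical
  obtain ⟨Φ, hΦ⟩ := loadAfterSteps_eq_restrict (N := N) x₀ s
  have h := hind.indepFun_finset (Finset.range s ×ˢ (Finset.univ : Finset (Sym2 (Fin n))))
    ({s} ×ˢ (Finset.univ : Finset (Sym2 (Fin n)))) (by
      rw [Finset.disjoint_left]
      rintro ⟨k, e⟩ h1 h2
      simp at h1 h2
      omega) hc
  simp only [hΦ]
  exact h.comp (measurable_of_countable Φ)
    (measurable_of_countable fun (r : ({s} ×ˢ (Finset.univ : Finset (Sym2 (Fin n))) : Finset _) →
      Bool) e => r ⟨(s, e), by simp⟩)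

/-- Exponential moments of the load for fixed initial loads: the rounding errors are subgaussian
with variance proxy bounded by the decrease of the square norm. -/
theorem lintegral_exp_loadAfterSteps_le (hN : ∀ i, (N i).IsMatching)
    (hc : ∀ q, Measurable (c q)) (hfair : ∀ q b, P.real {ω | c q ω = b} = 1 / 2)
    (hind : iIndepFun c P) (x₀ : Fin n → ℤ) (s : ℕ) (f : Fin n → ℝ) :
    ∫⁻ ω, ENNReal.ofReal (Real.exp (∑ u, f u *
        loadAfterSteps N (fun q => c q ω) x₀ s u)) ∂P ≤
      ENNReal.ofReal (Real.exp (
        ∑ u, backwardAverage (fun s => partner (N (Fin.ofNat d s))) s f u * x₀ u +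
        (∑ u, f u ^ 2 -
          ∑ u, backwardAverage (fun s => partner (N (Fin.ofNat d s))) s f u ^ 2) / 4)) := by
  induction s generalizing f with
  | zero => simp [loadAfterSteps, backwardAverage]
  | succ s ih =>
    set A := pairAverage (partner (N (Fin.ofNat d s))) f with hA
    have h1 := lintegral_le_lintegral_of_indepFun (indepFun_loadAfterSteps_coin (N := N) hc hind x₀ s)
      ((measurable_loadAfterSteps x₀ s).comp (measurable_pi_lambda _ hc))
      (measurable_pi_lambda _ fun e => hc (s, e))
      (H := fun x b => ENNReal.ofReal (Real.exp (∑ u, f u *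
        balanceStep (N (Fin.ofNat d s)) b x u)))
      (F := fun x => ENNReal.ofReal (Real.exp (∑ u, A u * x u +
        (∑ u, f u ^ 2 - ∑ u, A u ^ 2) / 4)))
      (measurable_of_countable _) (measurable_of_countable _)
      (fun x => lintegral_exp_balanceStep_le (fun e => hc (s, e)) (fun e => hfair (s, e))
        (hind.precomp (g := fun e => (s, e)) fun e e' h => (Prod.mk.inj h).2)
        (hN _) x f)
    -- Given the past, the last step leaves the functional `A` of the previous load and a constant
    -- factor; the induction hypothesis for `A` makes the norm drops telescope.
    refine h1.trans ?_
    have h2 := ih A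
    simp only [Real.exp_add, ENNReal.ofReal_mul (Real.exp_nonneg _)]
    have h3 : Measurable fun ω => ENNReal.ofReal (Real.exp (∑ u, A u *
        loadAfterSteps N (fun q => c q ω) x₀ s u)) :=
      (measurable_of_countable fun x : Fin n → ℤ =>
        ENNReal.ofReal (Real.exp (∑ u, A u * x u))).comp
        ((measurable_loadAfterSteps x₀ s).comp (measurable_pi_lambda _ hc))
    rw [lintegral_mul_const _ h3]
    refine (mul_le_mul_left h2 _).trans (le_of_eq ?_)
    rw [← ENNReal.ofReal_mul (Real.exp_nonneg _), ← ENNReal.ofReal_mul (Real.exp_nonneg _),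
      ← Real.exp_add, ← Real.exp_add, backwardAverage]
    congr 2
    ring

end Steps

/-! ### Exponential moments of a concentrated distribution. -/

section Moments

variable {D : Measure ℕ} {κ : ℝ}

/-- For `σ = 0` the tail event would be the whole space, whereas its probability is at most `exp
(-κ) < 1`. -/
theorem ExponentiallyConcentrated.stdDev_pos [IsProbabilityMeasure D] (hκ : 0 < κ)
    (h : ExponentiallyConcentrated D κ) : 0 < stdDev D := by
  refine (Real.sqrt_nonneg _).lt_of_ne' fun h0 => ?_
  have h1 := h.tail 1 one_pos
  have h2 : {k : ℕ | 1 * stdDev D ≤ |(k : ℝ) - mean D|} = Set.univ := by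
    ext k
    change stdDev D = 0 at h0
    simp [h0]
  rw [h2, probReal_univ, mul_one] at h1
  have : Real.exp (-κ) < 1 := by rw [Real.exp_lt_one_iff]; linarith
  linarith

/-- Layer-cake formula: levels up to 1 contribute at most 1. At level `r > 1` the tail with `δ = 2
log r / κ` gives `r⁻²`, which also integrates to 1; the 2 in the denominator of the exponent yields
this integrable power. -/
theorem ExponentiallyConcentrated.lintegral_exp_abs_le [IsProbabilityMeasure D] (hκ : 0 < κ)
    (h : ExponentiallyConcentrated D κ) :
    ∫⁻ k : ℕ, ENNReal.ofReal (Real.exp (κ * |(k : ℝ) - mean D| / (2 * stdDev D))) ∂D ≤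
      ENNReal.ofReal 2 := by
  have hσ := h.stdDev_pos hκ
  rw [lintegral_eq_lintegral_meas_le D (ae_of_all _ fun _ => Real.exp_nonneg _)
    (measurable_of_countable _).aemeasurable,
    ← Set.Ioc_union_Ioi_eq_Ioi (zero_le_one (α := ℝ)),
    lintegral_union measurableSet_Ioi
      (Set.disjoint_left.2 fun x hx hx' => not_lt.2 hx.2 hx'),
    show (2 : ℝ) = 1 + 1 by norm_num, ENNReal.ofReal_add zero_le_one zero_le_one]
  refine add_le_add ?_ ?_
  · calc _ ≤ ∫⁻ _ in Set.Ioc (0 : ℝ) 1, 1 := lintegral_mono fun _ => prob_le_one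
      _ = _ := by simp
  · have hint : ∫⁻ r in Set.Ioi (1 : ℝ), ENNReal.ofReal (r ^ (-2 : ℝ)) = ENNReal.ofReal 1 := by
      rw [← ofReal_integral_eq_lintegral_ofReal
        (integrableOn_Ioi_rpow_of_lt (by norm_num) one_pos)
        (ae_restrict_of_forall_mem measurableSet_Ioi fun r hr =>
          Real.rpow_nonneg (zero_le_one.trans (le_of_lt hr)) _),
        integral_Ioi_rpow_of_lt (by norm_num) one_pos]
      norm_num
    rw [← hint]
    refine setLIntegral_mono' measurableSet_Ioi fun r hr => ?_
    have hr1 : (1 : ℝ) < r := hr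
    have hr0 : 0 < r := one_pos.trans hr1
    have hlog := Real.log_pos hr1
    have h1 := h.tail (2 * Real.log r / κ) (by positivity)
    have h2 : Real.exp (-(κ * (2 * Real.log r / κ))) = r ^ (-2 : ℝ) := by
      rw [Real.rpow_def_of_pos hr0]
      congr 1
      field_simp
    rw [h2] at h1
    refine le_trans (measure_mono fun k hk => ?_) ((ENNReal.le_ofReal_iff_toReal_le
      (measure_ne_top _ _) (Real.rpow_nonneg hr0.le _)).2 h1)
    have h3 := (Real.log_le_iff_le_exp hr0).2 hk
    rw [le_div_iff₀ (by positivity)] at h3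
    change 2 * Real.log r / κ * stdDev D ≤ |(k : ℝ) - mean D|
    rw [div_mul_eq_mul_div, div_le_iff₀ hκ]
    linarith

theorem exp_le_one_add_self_add_sq_mul_exp_abs (x : ℝ) :
    Real.exp x ≤ 1 + x + x ^ 2 * Real.exp |x| := by
  have h1 : Real.exp x - 1 ≤ x * Real.exp x := by
    have h2 := mul_le_mul_of_nonneg_left (Real.add_one_le_exp (-x)) (Real.exp_nonneg x)
    rw [← Real.exp_add, add_neg_cancel, Real.exp_zero] at h2
    linarith
  rcases le_total 0 x with hx | hx
  · rw [abs_of_nonneg hx]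
    nlinarith
  · have h2 := Real.add_one_le_exp x
    have h3 := Real.one_le_exp (abs_nonneg x)
    have h4 : Real.exp x ≤ 1 := Real.exp_le_one_iff.2 hx
    nlinarith [sq_nonneg x]

/-- In the second-order expansion of the exponential the linear term has mean zero, and the
remainder is absorbed by the exponential moment already bounded by 2. -/
theorem ExponentiallyConcentrated.lintegral_exp_le [IsProbabilityMeasure D] (hκ : 0 < κ)
    (h : ExponentiallyConcentrated D κ) {s : ℝ} (hs : |s| * stdDev D ≤ κ / 4) :
    ∫⁻ k : ℕ, ENNReal.ofReal (Real.exp (s * ((k : ℝ) - mean D))) ∂D ≤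
      ENNReal.ofReal (Real.exp (64 * s ^ 2 * stdDev D ^ 2 / κ ^ 2)) := by
  have hσ := h.stdDev_pos hκ
  have hlin := h.lintegral_exp_abs_le hκ
  set σ := stdDev D with hσdef
  set E : ℕ → ℝ := fun k => Real.exp (κ * |(k : ℝ) - mean D| / (2 * σ)) with hE
  have hEint : Integrable E D :=
    ⟨(measurable_of_countable _).aestronglyMeasurable,
      (hasFiniteIntegral_iff_ofReal (ae_of_all _ fun _ => Real.exp_nonneg _)).2
        (hlin.trans_lt ENNReal.ofReal_lt_top)⟩
  have hE2 : ∫ k, E k ∂D ≤ 2 := by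
    rw [integral_eq_lintegral_of_nonneg_ae (ae_of_all _ fun _ => Real.exp_nonneg _)
      (measurable_of_countable _).aestronglyMeasurable]
    exact ENNReal.toReal_le_of_le_ofReal (by norm_num) hlin
  have hid : Integrable (fun k : ℕ => (k : ℝ)) D := h.memLp.integrable one_le_two
  have hbound : ∀ k : ℕ, Real.exp (s * ((k : ℝ) - mean D)) ≤
      1 + s * ((k : ℝ) - mean D) + 32 * s ^ 2 * σ ^ 2 / κ ^ 2 * E k := by
    intro k
    refine (exp_le_one_add_self_add_sq_mul_exp_abs _).trans ?_
    gcongr 1 + s * ((k : ℝ) - mean D) + ?_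
    set w := (k : ℝ) - mean D with hw
    -- Half of the available exponent: one factor `exp y` absorbs `y²`, the other `exp |s w|`, and
    -- their product is `E k`.
    set y := κ * |w| / (4 * σ) with hy
    have hy0 : 0 ≤ y := by positivity
    have h1 : |s * w| ≤ y := by
      rw [abs_mul, hy, le_div_iff₀ (by positivity)]
      nlinarith [abs_nonneg w]
    have h2 : y ^ 2 ≤ 2 * Real.exp y := by
      have := Real.quadratic_le_exp_of_nonneg hy0
      nlinarith
    have h3 : (s * w) ^ 2 = 16 * s ^ 2 * σ ^ 2 / κ ^ 2 * y ^ 2 := by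
      rw [hy, div_pow, mul_pow, mul_pow κ, sq_abs]
      field_simp
      ring
    have h4 : E k = Real.exp y * Real.exp y := by
      rw [← Real.exp_add]
      change Real.exp (κ * |w| / (2 * σ)) = _
      congr 1
      rw [hy]
      field_simp
      ring
    rw [h3, h4]
    calc 16 * s ^ 2 * σ ^ 2 / κ ^ 2 * y ^ 2 * Real.exp |s * w|
        ≤ 16 * s ^ 2 * σ ^ 2 / κ ^ 2 * (2 * Real.exp y) * Real.exp y := by gcongr
      _ = _ := by ring
  have hlinear : Integrable (fun k : ℕ => s * ((k : ℝ) - mean D)) D :=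
    (hid.sub (integrable_const _)).const_mul _
  have hone : Integrable (fun k : ℕ => 1 + s * ((k : ℝ) - mean D)) D :=
    (integrable_const _).add hlinear
  have hint : Integrable (fun k : ℕ => 1 + s * ((k : ℝ) - mean D) +
      32 * s ^ 2 * σ ^ 2 / κ ^ 2 * E k) D :=
    hone.add (hEint.const_mul _)
  calc _ ≤ ∫⁻ k : ℕ, ENNReal.ofReal (1 + s * ((k : ℝ) - mean D) +
        32 * s ^ 2 * σ ^ 2 / κ ^ 2 * E k) ∂D :=
        lintegral_mono fun k => ENNReal.ofReal_le_ofReal (hbound k)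
    _ = ENNReal.ofReal (∫ k : ℕ, (1 + s * ((k : ℝ) - mean D) +
        32 * s ^ 2 * σ ^ 2 / κ ^ 2 * E k) ∂D) :=
        (ofReal_integral_eq_lintegral_ofReal hint
          (ae_of_all _ fun k => (Real.exp_nonneg _).trans (hbound k))).symm
    _ ≤ _ := by
        refine ENNReal.ofReal_le_ofReal ?_
        rw [integral_add hone (hEint.const_mul _), integral_add (integrable_const _) hlinear,
          integral_const_mul, integral_const_mul, integral_sub hid (integrable_const _)]
        have hm : ∫ k : ℕ, (k : ℝ) ∂D = mean D := rfl
        rw [hm]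
        simp only [integral_const, probReal_univ, smul_eq_mul, one_mul, sub_self, mul_zero,
          add_zero]
        have h1 : 32 * s ^ 2 * σ ^ 2 / κ ^ 2 * ∫ k, E k ∂D ≤ 32 * s ^ 2 * σ ^ 2 / κ ^ 2 * 2 := by
          gcongr
        have h2 := Real.add_one_le_exp (64 * s ^ 2 * σ ^ 2 / κ ^ 2)
        have h3 : 32 * s ^ 2 * σ ^ 2 / κ ^ 2 * 2 = 64 * s ^ 2 * σ ^ 2 / κ ^ 2 := by ring
        linarith

end Moments

/-! ### Tail bounds for random initial loads, and the union bound. -/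

section AverageCase

variable {n d : ℕ} [NeZero d] {G : SimpleGraph (Fin n)} {N : Fin d → G.Subgraph}
  {D : Measure ℕ} [IsProbabilityMeasure D] {κ : ℝ}
  {Ω : Type*} [MeasurableSpace Ω] {P : Measure Ω} [IsProbabilityMeasure P]
  {X : Fin n → Ω → ℕ} {c : ℕ × Sym2 (Fin n) → Ω → Bool}

omit [IsProbabilityMeasure P] in
theorem lintegral_exp_sum_mul_load_le (hκ : 0 < κ) (hD : ExponentiallyConcentrated D κ)
    (hX : ∀ u, Measurable (X u)) (hlaw : ∀ u, P.map (X u) = D) (hind : iIndepFun X P)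
    (g : Fin n → ℝ) (hg0 : ∑ u, g u = 0) (hg : ∀ u, |g u| * stdDev D ≤ κ / 4) :
    ∫⁻ ω, ENNReal.ofReal (Real.exp (∑ u, g u * X u ω)) ∂P ≤
      ENNReal.ofReal (Real.exp (64 * stdDev D ^ 2 / κ ^ 2 * ∑ u, g u ^ 2)) := by
  have h1 : ∀ ω, ∑ u, g u * (X u ω : ℝ) = ∑ u, g u * ((X u ω : ℝ) - mean D) := by
    intro ω
    simp only [mul_sub, Finset.sum_sub_distrib, ← Finset.sum_mul, hg0]
    ring
  have hmeas : ∀ u, Measurable fun k : ℕ =>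
      ENNReal.ofReal (Real.exp (g u * ((k : ℝ) - mean D))) := fun u => measurable_of_countable _
  simp only [h1, Real.exp_sum, ENNReal.ofReal_prod_of_nonneg fun _ _ => Real.exp_nonneg _]
  rw [lintegral_prod_eq_prod_lintegral_of_indepFun Finset.univ
    (fun u ω => ENNReal.ofReal (Real.exp (g u * ((X u ω : ℝ) - mean D))))
    (hind.comp _ hmeas) fun u => (hmeas u).comp (hX u), Finset.mul_sum, Real.exp_sum,
    ENNReal.ofReal_prod_of_nonneg fun _ _ => Real.exp_nonneg _]
  refine Finset.prod_le_prod' fun u _ => ?_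
  rw [← lintegral_map (hmeas u) (hX u), hlaw]
  refine (hD.lintegral_exp_le hκ (hg u)).trans (le_of_eq ?_)
  congr 2
  ring

/-- Exponential moments of linear functionals of the load vector. -/
theorem AverageCase.lintegral_exp_loadAfterSteps_le (hκ : 0 < κ)
    (hD : ExponentiallyConcentrated D κ) (hN : ∀ i, (N i).IsMatching) (h : AverageCase P D X c)
    (s : ℕ) (f : Fin n → ℝ) (hf : ∑ u, f u = 0)
    (hB : ∀ u, |backwardAverage (fun s => partner (N (Fin.ofNat d s))) s f u| * stdDev D ≤
      κ / 4) :
    ∫⁻ ω, ENNReal.ofReal (Real.exp (∑ u, f u *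
        loadAfterSteps N (fun q => c q ω) (fun u => (X u ω : ℤ)) s u)) ∂P ≤
      ENNReal.ofReal (Real.exp ((∑ u, f u ^ 2) / 4 + 64 * stdDev D ^ 2 / κ ^ 2 *
        ∑ u, backwardAverage (fun s => partner (N (Fin.ofNat d s))) s f u ^ 2)) := by
  set B := backwardAverage (fun s => partner (N (Fin.ofNat d s))) s f with hBdef
  have hp : ∀ s, (partner (N (Fin.ofNat d s))).Involutive := fun s => partner_involutive (hN _)
  have hXm : Measurable fun ω u => X u ω := measurable_pi_lambda _ h.measurable_load
  have h1 := lintegral_le_lintegral_of_indepFun h.indep_load_coin hXm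
    (measurable_pi_lambda _ h.measurable_coin)
    (H := fun y b => ENNReal.ofReal (Real.exp (∑ u, f u *
      loadAfterSteps N b (fun u => (y u : ℤ)) s u)))
    (F := fun y => ENNReal.ofReal (Real.exp (∑ u, B u * y u +
      (∑ u, f u ^ 2 - ∑ u, B u ^ 2) / 4)))
    (measurable_comp_loadAfterSteps (fun x => ENNReal.ofReal (Real.exp (∑ u, f u * x u))) s)
    (measurable_of_countable _)
    (fun y => (LoadBalancing.lintegral_exp_loadAfterSteps_le hN h.measurable_coin h.fair_coin
      h.indep_coin (fun u => (y u : ℤ)) s f).trans (le_of_eq (by simp [hBdef])))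
  refine h1.trans ?_
  have h2 := lintegral_exp_sum_mul_load_le hκ hD h.measurable_load h.law_load h.indep_load B
    (by rw [hBdef, sum_backwardAverage hp, hf]) hB
  simp only [Real.exp_add, ENNReal.ofReal_mul (Real.exp_nonneg _)]
  have h3 : Measurable fun ω => ENNReal.ofReal (Real.exp (∑ u, B u * (X u ω : ℝ))) :=
    (measurable_of_countable fun y : Fin n → ℕ =>
      ENNReal.ofReal (Real.exp (∑ u, B u * (y u : ℝ)))).comp hXm
  rw [lintegral_mul_const _ h3, mul_comm (ENNReal.ofReal (Real.exp ((∑ u, f u ^ 2) / 4)))]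
  refine mul_le_mul' h2 (ENNReal.ofReal_le_ofReal (Real.exp_le_exp.2 ?_))
  have : 0 ≤ ∑ u, B u ^ 2 := Finset.sum_nonneg fun u _ => sq_nonneg _
  linarith

theorem backwardAverage_const_mul {V : Type*} (p : ℕ → V → V) (s : ℕ) (a : ℝ) (f : V → ℝ) :
    backwardAverage p s (fun u => a * f u) = fun u => a * backwardAverage p s f u := by
  induction s generalizing f with
  | zero => rfl
  | succ s ih =>
    rw [backwardAverage, backwardAverage, ← ih]
    congr 1
    funext u
    simp only [pairAverage]
    ring

/-- Tail bound for a linear functional of the load vector, at the scale `L` of the logarithm of the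
failure probability. -/
theorem AverageCase.measureReal_le_exp (hκ : 0 < κ)
    (hD : ExponentiallyConcentrated D κ) (hN : ∀ i, (N i).IsMatching) (h : AverageCase P D X c)
    (s : ℕ) (f : Fin n → ℝ) (hf : ∑ u, f u = 0) (hf2 : ∑ u, f u ^ 2 ≤ 1) {φ L : ℝ} (hφ : 0 < φ)
    (hL : 0 < L)
    (hB : ∑ u, backwardAverage (fun s => partner (N (Fin.ofNat d s))) s f u ^ 2 ≤ φ ^ 2) :
    P.real {ω | (3 + 12 / κ) * (stdDev D * φ * L + √L) ≤ ∑ u, f u *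
        loadAfterSteps N (fun q => c q ω) (fun u => (X u ω : ℤ)) s u} ≤
      Real.exp (4 - 2 * L) := by
  have hσ := hD.stdDev_pos hκ
  set σ := stdDev D with hσdef
  set B := backwardAverage (fun s => partner (N (Fin.ofNat d s))) s f with hBdef
  -- Chernoff parameter: `√L` is the subgaussian choice for the rounding errors, and the cap keeps
  -- the initial loads in the range where their exponential moment is controlled.
  set l := min (√L) (κ / (4 * σ * φ)) with hl
  have hl0 : 0 < l := lt_min (Real.sqrt_pos.2 hL) (by positivity)
  have hl1 : l ^ 2 ≤ L := by
    calc l ^ 2 ≤ √L ^ 2 := pow_le_pow_left₀ hl0.le (min_le_left _ _) 2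
      _ = L := Real.sq_sqrt hL.le
  have hl2 : l * (σ * φ) ≤ κ / 4 := by
    have h1 : l ≤ κ / (4 * σ * φ) := min_le_right _ _
    rw [le_div_iff₀ (by positivity)] at h1
    linarith
  -- If `√L` attains the minimum, the `√L` term of the threshold suffices; otherwise the `σ φ L`
  -- term does. Against the moment exponent `L / 4 + 4` this leaves at most `4 - 2 L`.
  have hl3 : 3 * L ≤ l * ((3 + 12 / κ) * (σ * φ * L + √L)) := by
    rcases min_choice (√L) (κ / (4 * σ * φ)) with h1 | h1
    · calc 3 * L = √L * (3 * √L) := by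
            rw [mul_left_comm, Real.mul_self_sqrt hL.le]
        _ ≤ √L * ((3 + 12 / κ) * (σ * φ * L + √L)) := by
            gcongr
            · have : 0 ≤ 12 / κ := by positivity
              linarith
            · have : 0 ≤ σ * φ * L := by positivity
              linarith
        _ = _ := by rw [hl, h1]
    · calc 3 * L = κ / (4 * σ * φ) * (12 / κ * (σ * φ * L)) := by field_simp; norm_num
        _ ≤ κ / (4 * σ * φ) * ((3 + 12 / κ) * (σ * φ * L + √L)) := by
            gcongr
            · linarith
            · linarith [Real.sqrt_nonneg L]
        _ = _ := by rw [hl, h1]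
  have hBu : ∀ u, |B u| ≤ φ := fun u =>
    abs_le_of_sq_le_sq ((Finset.single_le_sum (f := fun u => B u ^ 2) (fun u _ => sq_nonneg _)
      (Finset.mem_univ u)).trans hB) hφ.le
  set Y : Ω → ℝ := fun ω => ∑ u, f u *
    loadAfterSteps N (fun q => c q ω) (fun u => (X u ω : ℤ)) s u with hY
  have hmgf : ∫⁻ ω, ENNReal.ofReal (Real.exp (l * Y ω)) ∂P ≤
      ENNReal.ofReal (Real.exp (L / 4 + 4)) := by
    have h1 := h.lintegral_exp_loadAfterSteps_le hκ hD hN s (fun u => l * f u)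
      (by rw [← Finset.mul_sum, hf, mul_zero]) (by
        intro u
        rw [backwardAverage_const_mul, abs_mul, abs_of_pos hl0]
        calc l * |B u| * σ ≤ l * φ * σ := by gcongr; exact hBu u
          _ ≤ κ / 4 := by linarith)
    simp only [mul_assoc l, ← Finset.mul_sum] at h1
    refine h1.trans (ENNReal.ofReal_le_ofReal (Real.exp_le_exp.2 (add_le_add ?_ ?_)))
    · simp only [mul_pow, ← Finset.mul_sum]
      have : l ^ 2 * ∑ u, f u ^ 2 ≤ L * 1 := by
        gcongr
      linarith
    · rw [backwardAverage_const_mul]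
      simp only [mul_pow, ← Finset.mul_sum]
      calc 64 * σ ^ 2 / κ ^ 2 * (l ^ 2 * ∑ u, B u ^ 2)
          ≤ 64 * σ ^ 2 / κ ^ 2 * (l ^ 2 * φ ^ 2) := by gcongr
        _ = 64 / κ ^ 2 * (l * (σ * φ)) ^ 2 := by ring
        _ ≤ 64 / κ ^ 2 * (κ / 4) ^ 2 := by gcongr
        _ = 4 := by field_simp; norm_num
  have hYm : Measurable Y := by
    have h1 : Measurable (Function.uncurry fun (y : Fin n → ℕ) (b : ℕ × Sym2 (Fin n) → Bool) =>
        ∑ u, f u * (loadAfterSteps N b (fun u => (y u : ℤ)) s u : ℝ)) :=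
      measurable_comp_loadAfterSteps (fun x => ∑ u, f u * (x u : ℝ)) s
    exact h1.comp ((measurable_pi_lambda _ h.measurable_load).prodMk
      (measurable_pi_lambda _ h.measurable_coin))
  set a := (3 + 12 / κ) * (σ * φ * L + √L) with ha
  have hmarkov := mul_meas_ge_le_lintegral (μ := P)
    (f := fun ω => ENNReal.ofReal (Real.exp (l * Y ω))) (by fun_prop)
    (ENNReal.ofReal (Real.exp (l * a)))
  have hsub : {ω | a ≤ Y ω} ⊆
      {ω | ENNReal.ofReal (Real.exp (l * a)) ≤ ENNReal.ofReal (Real.exp (l * Y ω))} :=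
    fun ω hω => ENNReal.ofReal_le_ofReal
      (Real.exp_le_exp.2 (mul_le_mul_of_nonneg_left hω hl0.le))
  have h2 : ENNReal.ofReal (Real.exp (l * a)) * P {ω | a ≤ Y ω} ≤
      ENNReal.ofReal (Real.exp (L / 4 + 4)) :=
    (mul_le_mul_right (measure_mono hsub) _).trans (hmarkov.trans hmgf)
  have h3 := ENNReal.toReal_mono ENNReal.ofReal_ne_top h2
  rw [ENNReal.toReal_mul, ENNReal.toReal_ofReal (Real.exp_nonneg _),
    ENNReal.toReal_ofReal (Real.exp_nonneg _), ← measureReal_def] at h3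
  calc P.real {ω | a ≤ Y ω} ≤ Real.exp (L / 4 + 4) / Real.exp (l * a) := by
        rw [le_div_iff₀ (Real.exp_pos _), mul_comm]
        exact h3
    _ = Real.exp (L / 4 + 4 - l * a) := (Real.exp_sub _ _).symm
    _ ≤ _ := Real.exp_le_exp.2 (by linarith)

theorem exists_disc_le [NeZero n] (x : Fin n → ℤ) :
    ∃ a b, disc x = x a - x b := by
  obtain ⟨a, ha⟩ := exists_eq_ciSup_of_finite (f := x)
  obtain ⟨b, hb⟩ := exists_eq_ciInf_of_finite (f := x)
  exact ⟨a, b, by rw [disc, ha, hb]⟩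

theorem AverageCase.one_sub_le_measureReal_disc_le [NeZero n] (hκ : 0 < κ)
    (hD : ExponentiallyConcentrated D κ) (hN : ∀ i, (N i).IsMatching)
    (hlam : secondEigenvalue (roundMatrix N) < 1) (h : AverageCase P D X c) (t : ℕ) {φ L : ℝ}
    (hφ : 0 < φ) (hL : 0 < L) (hφt : 1 ≤ φ ^ 4 * (1 / (256 * d ^ 2 * 2 ^ d) * t)) :
    1 - 2 * n * Real.exp (4 - 2 * L) ≤ P.real {ω |
      (disc (loadAfterRounds N (fun q => c q ω) (fun u => (X u ω : ℤ)) t) : ℝ) ≤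
        2 * ((3 + 12 / κ) * (stdDev D * φ * L + √L))} := by
  classical
  set a := (3 + 12 / κ) * (stdDev D * φ * L + √L) with ha
  set p : ℕ → Fin n → Fin n := fun s => partner (N (Fin.ofNat d s)) with hpdef
  have hp : ∀ s, (p s).Involutive := fun s => partner_involutive (hN _)
  have hper : ∀ m k, p (m * d + k) = p k := by
    intro m k
    have : Fin.ofNat d (m * d + k) = Fin.ofNat d k := by
      ext
      simp
    simp only [hpdef, this]
  have hconn := connected_of_secondEigenvalue_lt_one hN hlam
  have hn : (0 : ℝ) < n := by exact_mod_cast Nat.pos_of_ne_zero (NeZero.ne n)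
  have hn1 : (1 : ℝ) ≤ n := by exact_mod_cast Nat.one_le_iff_ne_zero.2 (NeZero.ne n)
  set x : Ω → Fin n → ℤ := fun ω =>
    loadAfterSteps N (fun q => c q ω) (fun u => (X u ω : ℤ)) (t * d) with hx
  -- The sign `r = ±1` selects deviation above or below the average; centring gives sum zero, `ℓ¹`
  -- norm at most 2 and square norm at most 1.
  set e : ℝ → Fin n → Fin n → ℝ := fun r w u => r * ((if w = u then 1 else 0) - 1 / n) with he
  have he0 : ∀ r w, ∑ u, e r w u = 0 := by
    intro r w
    rw [← Finset.mul_sum]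
    simp [hn.ne']
  have he1 : ∀ r w, |r| = 1 → ∑ u, |e r w u| ≤ 2 := by
    intro r w hr
    calc ∑ u, |e r w u| ≤ ∑ u, ((if w = u then 1 else 0) + 1 / (n : ℝ)) := by
          refine Finset.sum_le_sum fun u _ => ?_
          rw [he, abs_mul, hr, one_mul]
          refine (abs_sub _ _).trans (le_of_eq ?_)
          rw [abs_of_pos (by positivity : (0 : ℝ) < 1 / n)]
          split_ifs <;> simp
      _ = 2 := by
          rw [Finset.sum_add_distrib]
          simp [hn.ne']
          norm_num
  have he2 : ∀ r w, |r| = 1 → ∑ u, e r w u ^ 2 ≤ 1 := by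
    intro r w hr
    have hr2 : r ^ 2 = 1 := by rw [← sq_abs, hr, one_pow]
    calc ∑ u, e r w u ^ 2 = ∑ u, ((if w = u then 1 - 2 / (n : ℝ) else 0) + (1 / (n : ℝ)) ^ 2) := by
          refine Finset.sum_congr rfl fun u _ => ?_
          rw [he, mul_pow, hr2]
          split_ifs <;> ring
      _ = 1 - 1 / n := by
          rw [Finset.sum_add_distrib]
          simp
          field_simp
          ring
      _ ≤ 1 := by
          have : 0 ≤ 1 / (n : ℝ) := by positivity
          linarith
  have htail : ∀ r w, |r| = 1 → P.real {ω | a ≤ ∑ u, e r w u * x ω u} ≤ Real.exp (4 - 2 * L) := by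
    intro r w hr
    refine h.measureReal_le_exp hκ hD hN (t * d) (e r w) (he0 r w) (he2 r w hr) hφ hL ?_
    have hdec := sum_sq_backwardAverage_decay (NeZero.pos d) hconn hp hper t (e r w) (he0 r w)
      (he1 r w hr)
    have hk : 0 < 1 / (256 * (d : ℝ) ^ 2 * 2 ^ d) * t := by
      refine lt_of_le_of_ne (by positivity) fun h0 => ?_
      rw [← h0] at hφt
      linarith
    refine (pow_le_pow_iff_left₀ (Finset.sum_nonneg fun u _ => sq_nonneg _) (by positivity)
      two_ne_zero).1 ?_
    refine le_of_mul_le_mul_right ?_ hk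
    calc _ ≤ 1 := hdec
      _ ≤ _ := hφt
      _ = _ := by ring
  set good := {ω | (disc (loadAfterRounds N (fun q => c q ω) (fun u => (X u ω : ℤ)) t) : ℝ) ≤
    2 * a} with hgood
  have hcover : goodᶜ ⊆ ⋃ w, ({ω | a ≤ ∑ u, e 1 w u * x ω u} ∪
      {ω | a ≤ ∑ u, e (-1) w u * x ω u}) := by
    intro ω hω
    by_contra hno
    simp only [Set.mem_iUnion, Set.mem_union, Set.mem_ofPred_eq, not_exists, not_or, not_le] at hno
    apply hω
    obtain ⟨v, w, hvw⟩ := exists_disc_le (x ω)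
    have hval : ∀ r w, ∑ u, e r w u * x ω u = r * (x ω w - (∑ u, (x ω u : ℝ)) / n) := by
      intro r w
      simp only [he, mul_assoc, ← Finset.mul_sum, sub_mul, Finset.sum_sub_distrib]
      congr 1
      simp
      ring
    have h1 := (hno v).1
    have h2 := (hno w).2
    rw [hval] at h1 h2
    change (disc (x ω) : ℝ) ≤ 2 * a
    rw [hvw]
    push_cast
    linarith
  have hbad : P.real goodᶜ ≤ 2 * n * Real.exp (4 - 2 * L) := by
    calc P.real goodᶜ ≤ _ := measureReal_mono hcover
      _ ≤ _ := measureReal_iUnion_fintype_le _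
      _ ≤ ∑ _w : Fin n, (Real.exp (4 - 2 * L) + Real.exp (4 - 2 * L)) :=
          Finset.sum_le_sum fun w _ => (measureReal_union_le _ _).trans
            (add_le_add (htail 1 w (by simp)) (htail (-1) w (by simp)))
      _ = _ := by simp; ring
  have hunion : 1 ≤ P.real good + P.real goodᶜ := by
    rw [← probReal_univ (μ := P), ← Set.union_compl_self good]
    exact measureReal_union_le _ _
  linarith

end AverageCase

end LoadBalancing

/-! ### Choice of constants and conclusion. -/

open LoadBalancing
theorem theorem3 (d : ℕ) [NeZero d] (κ : ℝ) (hκ : 0 < κ) :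
    ∃ C : ℝ, 0 < C ∧
      ∀ (n : ℕ) (G : SimpleGraph (Fin n)), G.Connected →
      ∀ N : Fin d → G.Subgraph, (∀ i, (N i).IsMatching) →
        secondEigenvalue (roundMatrix N) < 1 →
      ∀ (D : MeasureTheory.Measure ℕ) [MeasureTheory.IsProbabilityMeasure D],
        ExponentiallyConcentrated D κ →
      ∀ (Ω : Type*) [MeasurableSpace Ω] (P : MeasureTheory.Measure Ω)
        [MeasureTheory.IsProbabilityMeasure P]
        (X : Fin n → Ω → ℕ) (c : ℕ × Sym2 (Fin n) → Ω → Bool),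
        AverageCase P D X c →
      ∀ t : ℕ, 1 ≤ t →
        1 - C / n ≤ P.real {ω |
          (disc (loadAfterRounds N (fun p => c p ω) (fun u => (X u ω : ℤ)) t) : ℝ) ≤
            C * ((t : ℝ) ^ (-(1 / 4) : ℝ) * stdDev D * Real.log n ^ (3 / 2 : ℝ)
              + √(Real.log n))} := by
  set b : ℝ := 1 / (256 * d ^ 2 * 2 ^ d) with hb
  have hd : (0 : ℝ) < d := by exact_mod_cast NeZero.pos d
  have hb0 : 0 < b := by positivity
  set B : ℝ := b ^ (-(1 / 4) : ℝ) with hB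
  have hB0 : 0 < B := Real.rpow_pos_of_pos hb0 _
  set K : ℝ := 3 + 12 / κ with hK
  have hK0 : 0 < K := by positivity
  -- The first summand covers the failure probability `2 e⁴ / n`, the second the size of the
  -- discrepancy.
  set C : ℝ := 2 * Real.exp 4 + 2 * K * (1 + 2 * B) with hC
  have hC0 : 0 < C := by positivity
  refine ⟨C, hC0, fun n G hG N hN hlam D _ hD Ω _ P _ X c h t ht => ?_⟩
  obtain ⟨w⟩ := hG.nonempty
  have : NeZero n := ⟨fun hn => by subst hn; exact w.elim0⟩
  have ht0 : (0 : ℝ) < t := by exact_mod_cast ht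
  -- For `n = 1` the claimed probability bound `1 - C` is not positive; for `n ≥ 2` the logarithm is
  -- bounded away from 0.
  rcases Nat.lt_or_ge n 2 with hn | hn
  · have hn1 : n = 1 := by
      have := NeZero.ne n
      omega
    have h1 : 1 ≤ C := by
      have h2 := Real.one_le_exp (show (0 : ℝ) ≤ 4 by norm_num)
      have h3 : 0 ≤ 2 * K * (1 + 2 * B) := by positivity
      linarith
    refine le_trans ?_ measureReal_nonneg
    rw [hn1, Nat.cast_one, div_one]
    linarith
  · have hn2 : (2 : ℝ) ≤ n := by exact_mod_cast hn
    have hn0 : (0 : ℝ) < n := by linarith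
    set L := Real.log n with hL
    have hL4 : 1 / 4 ≤ L := by
      have h1 := Real.log_two_gt_d9
      have h2 := Real.log_le_log (by norm_num) hn2
      linarith
    have hL0 : 0 < L := by linarith
    have hσ := hD.stdDev_pos hκ
    have hexp : 2 * n * Real.exp (4 - 2 * L) = 2 * Real.exp 4 / n := by
      rw [Real.exp_sub, show 2 * L = L + L by ring, Real.exp_add, hL, Real.exp_log hn0]
      field_simp
    have hT : 0 < (t : ℝ) ^ (-(1 / 4) : ℝ) := Real.rpow_pos_of_pos ht0 _
    have hpow : ∀ y : ℝ, 0 < y → (y ^ (-(1 / 4) : ℝ)) ^ 4 = y⁻¹ := by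
      intro y hy
      rw [← Real.rpow_natCast, ← Real.rpow_mul hy.le, ← Real.rpow_neg_one]
      norm_num
    -- `φ = (b t)^(-1/4)` gives equality in the decay condition.
    have hmain := h.one_sub_le_measureReal_disc_le hκ hD hN hlam t
      (φ := B * (t : ℝ) ^ (-(1 / 4) : ℝ)) (L := L) (by positivity) hL0 (by
        rw [mul_pow, hB, hpow b hb0, hpow t ht0]
        apply le_of_eq
        rw [← hb]
        field_simp)
    rw [hexp] at hmain
    -- The argument yields `log n` to the first power; it is weakened here to the stated exponent,
    -- using `log n ≥ 1/4`.
    have hLL : L ≤ 2 * L ^ (3 / 2 : ℝ) := by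
      have h1 : L ^ (3 / 2 : ℝ) = L * √L := by
        rw [Real.sqrt_eq_rpow, ← Real.rpow_one_add' hL0.le (by norm_num)]
        norm_num
      have h2 : 1 / 2 ≤ √L := Real.le_sqrt_of_sq_le (by norm_num; linarith)
      rw [h1]
      nlinarith
    refine le_trans ?_ (hmain.trans (measureReal_mono fun ω hω =>
      show (_ : ℝ) ≤ _ from le_trans hω ?_))
    · have h1 : 2 * Real.exp 4 ≤ C := by
        have : 0 ≤ 2 * K * (1 + 2 * B) := by positivity
        linarith
      gcongr
    · set T := (t : ℝ) ^ (-(1 / 4) : ℝ) with hTdef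
      have hS : 0 ≤ √L := Real.sqrt_nonneg L
      set R := T * stdDev D * L ^ (3 / 2 : ℝ) with hR
      have hR0 : 0 ≤ R := by positivity
      have h1 : stdDev D * (B * T) * L ≤ 2 * B * R := by
        calc stdDev D * (B * T) * L ≤ stdDev D * (B * T) * (2 * L ^ (3 / 2 : ℝ)) := by gcongr
          _ = 2 * B * R := by rw [hR]; ring
      calc 2 * (K * (stdDev D * (B * T) * L + √L))
          ≤ 2 * (K * (2 * B * R + √L)) := by gcongr
        _ ≤ 2 * (K * ((1 + 2 * B) * R + (1 + 2 * B) * √L)) := by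
            gcongr
            · linarith
            · nlinarith
        _ = 2 * K * (1 + 2 * B) * (R + √L) := by ring
        _ ≤ C * (R + √L) := by
            gcongr
            have := Real.exp_pos 4
            linarith
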